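/- Let $\hbar,\delta_x,\delta_p>0$ and let $\{I_k\}_{k\in\mathbb N}$, $\{J_k\}_{k\in\mathbb N}$ be partitions of $\mathbb R$ into intervals of constant length $\delta_x$ and $\delta_p$, respectively. On $n$ modes, i.e. on $L^2(\mathbb R^n)$ with $[X_i,P_j]=i\hbar\delta_{ij}$, choose $\theta\in\{0,1\}^n$ uniformly at random, measure mode $i$ with the coarse-grained position measurement $X_{\delta_x}$ (which bin $I_k$ contains $X_i$) if $\theta_i=0$ and with the coarse-grained momentum measurement $P_{\delta_p}$ (which bin $J_k$ contains $P_i$) if $\theta_i=1$, and let $Z\in\mathbb N^n$ be the string of outcomes. A state is Gaussian if its characteristic function $\operatorname{tr}(\rho\, e^{i(a\cdot X+b\cdot P)})$ is of the form $\exp(i\,d\cdot\xi-\tfrac12\,\xi\cdot V\xi)$, $\xi=(a,b)\in\mathbb R^{2n}$, with $d\in\mathbb R^{2n}$ and $V$ real symmetric; a Gaussian mixture is a state $\rho=\int\rho^y\,d\nu(y)$ (weak integral) with $\nu$ a probability measure on any measurable space and all $\rho^y$ Gaussian. All logarithms are to base $2$. For discrete random variables put $$H_\alpha(Z|Y)=\tfrac1{1-\alpha}\log\sum_{z,y}p(z,y)^\alpha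 p(y)^{1-\alpha},\qquad H_{\min}(Z|Y)=-\log p_{\mathrm{guess}}(Z|Y),$$ where $p_{\mathrm{guess}}(Z|Y)$ is the maximal probability of guessing $Z$ from $Y$, and let $H^\epsilon_{\min}(Z|Y)_p$ be the supremum of $H_{\min}(Z|Y)_q$ over all joint probability distributions $q$ with purified distance $\sqrt{1-F(p,q)}\le\epsilon$, where $F(p,q)=\big(\sum\sqrt{pq}\big)^2$. Finally let $$B^\alpha_{\mathrm{Gauss}}=\frac1{1-\alpha}\log\frac12\Big(1+\frac1\alpha\Big(\frac{\delta_x\delta_p}{\pi\hbar}\Big)^{\alpha-1}\Big),\qquad c=\frac{\delta_x\delta_p}{\pi e\hbar},$$ $$\lambda^\epsilon_{\mathrm{Gauss}}(n)=\sup_{1<\alpha\le2}\Big(B^\alpha_{\mathrm{Gauss}}-\frac1{n(\alpha-1)}\log\frac2{\epsilon^2}\Big).$$ Then: 1. For $n=1$, every $\alpha\in(1,2]$ and every one-mode Gaussian mixture, $H_\alpha(Z|\theta)\ge B^\alpha_{\mathrm{Gauss}}$. 2. For every $n\ge1$, $\epsilon\in(0,1]$ and discrete random variable $K$ (independent of $\theta$)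 such that the state of the $n$ modes given $K=k$ is a Gaussian mixture $\rho^k$ for every $k$, $\frac1nH^\epsilon_{\min}(Z|\theta K)\ge\lambda^\epsilon_{\mathrm{Gauss}}(n)$. 3. $\lim_{\alpha\downarrow1}B^\alpha_{\mathrm{Gauss}}=-\tfrac12\log c$, and for every $\epsilon\in(0,1]$, $\lim_{n\to\infty}\lambda^\epsilon_{\mathrm{Gauss}}(n)=-\tfrac12\log c$. -/

import Mathlib

open MeasureTheory Filter Topology
open scoped ENNReal FourierTransform

universe u v

noncomputable section

namespace CVGauss

/-! ### The `n`-mode Hilbert space and its basic operators -/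

/-- Configuration space `ℝⁿ` of `n` modes. -/
abbrev Conf (n : ℕ) : Type := EuclideanSpace ℝ (Fin n)

/-- The Hilbert space `L²(ℝⁿ; ℂ)` of `n` bosonic modes in the Schrödinger representation. -/
abbrev Modes (n : ℕ) : Type := Lp ℂ 2 (volume : Measure (Conf n))

theorem memLp_top_of_bdd {n : ℕ} {f : Conf n → ℂ} (hf : Measurable f) (hb : ∀ x, ‖f x‖ ≤ 1) :
    MemLp f ∞ (volume : Measure (Conf n)) :=
  memLp_top_of_bound hf.aestronglyMeasurable 1 (Filter.Eventually.of_forall hb)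

/-- Multiplication by a measurable function bounded by one, as an operator on `L²(ℝⁿ)`. -/
def mulOp {n : ℕ} (f : Conf n → ℂ) (hf : Measurable f) (hb : ∀ x, ‖f x‖ ≤ 1) :
    Modes n →L[ℂ] Modes n :=
  (ContinuousLinearMap.mul ℂ ℂ).holderL volume ∞ 2 2 ((memLp_top_of_bdd hf hb).toLp f)

theorem measurable_indicator_one {n : ℕ} {s : Set (Conf n)} (hs : MeasurableSet s) :
    Measurable (s.indicator (fun _ => (1 : ℂ))) :=
  measurable_const.indicator hs

theorem norm_indicator_one_le {n : ℕ} (s : Set (Conf n)) (x : Conf n) :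
    ‖s.indicator (fun _ => (1 : ℂ)) x‖ ≤ 1 := by
  by_cases h : x ∈ s <;> simp [h]

/-- The projection `ψ ↦ 1_s ψ` in the position representation. -/
def posProj {n : ℕ} (s : Set (Conf n)) (hs : MeasurableSet s) : Modes n →L[ℂ] Modes n :=
  mulOp (s.indicator fun _ => 1) (measurable_indicator_one hs) (norm_indicator_one_le s)

theorem measurableSet_smul_preimage {n : ℕ} (c : ℝ) {s : Set (Conf n)} (hs : MeasurableSet s) :
    MeasurableSet ((fun ξ : Conf n => c • ξ) ⁻¹' s) :=
  (measurable_const_smul c) hs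

/-- The projection onto "the momentum vector `P = -iħ∇` lies in `s`". With Mathlib's convention
`𝓕 ψ ξ = ∫ exp(-2πi⟨x, ξ⟩) ψ(x) dx`, momentum `p` corresponds to the frequency `ξ = p / (2πħ)`. -/
def momProj {n : ℕ} (ħ : ℝ) (s : Set (Conf n)) (hs : MeasurableSet s) :
    Modes n →L[ℂ] Modes n :=
  ((Lp.fourierTransformₗᵢ (Conf n) ℂ).symm.toContinuousLinearEquiv :
      Modes n →L[ℂ] Modes n) ∘L
    posProj ((fun ξ : Conf n => (2 * Real.pi * ħ) • ξ) ⁻¹' s)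
      (measurableSet_smul_preimage _ hs) ∘L
    ((Lp.fourierTransformₗᵢ (Conf n) ℂ).toContinuousLinearEquiv : Modes n →L[ℂ] Modes n)

/-- Translation `(T_c ψ)(x) = ψ(x + c)`. -/
def translation {n : ℕ} (c : Conf n) : Modes n →L[ℂ] Modes n :=
  (Lp.compMeasurePreservingₗᵢ ℂ (fun x : Conf n => x + c)
    (measurePreserving_add_right volume c)).toContinuousLinearMap

/-- The phase of the Weyl operator. -/
def weylPhase {n : ℕ} (ħ : ℝ) (a b x : Conf n) : ℂ :=
  Complex.exp (Complex.I * ((inner ℝ a x + ħ * inner ℝ a b / 2 : ℝ) : ℂ))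

theorem measurable_weylPhase {n : ℕ} (ħ : ℝ) (a b : Conf n) :
    Measurable (weylPhase ħ a b) := by
  have : Continuous (weylPhase ħ a b) := by
    unfold weylPhase
    fun_prop
  exact this.measurable

theorem norm_weylPhase_le {n : ℕ} (ħ : ℝ) (a b x : Conf n) : ‖weylPhase ħ a b x‖ ≤ 1 := by
  unfold weylPhase
  rw [mul_comm, Complex.norm_exp_ofReal_mul_I]

/-- The Weyl operator `W(a, b) = exp(i (a·X + b·P))`, i.e.
`(W(a, b) ψ)(x) = exp(i a·x + i ħ a·b / 2) ψ(x + ħ b)`. -/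
def weyl {n : ℕ} (ħ : ℝ) (a b : Conf n) : Modes n →L[ℂ] Modes n :=
  mulOp (weylPhase ħ a b) (measurable_weylPhase ħ a b) (norm_weylPhase_le ħ a b) ∘L
    translation (ħ • b)

/-! ### States -/

/-- The index set of a fixed orthonormal basis of the Hilbert space. -/
def basisIndex (n : ℕ) : Set (Modes n) := (exists_hilbertBasis ℂ (Modes n)).choose

/-- A fixed orthonormal (Hilbert) basis. -/
def basis (n : ℕ) : HilbertBasis (basisIndex n) ℂ (Modes n) :=
  (exists_hilbertBasis ℂ (Modes n)).choose_spec.choose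

/-- The trace of an operator. It is only applied to trace class operators, for which the series
converges absolutely and does not depend on the basis. -/
def trace {n : ℕ} (T : Modes n →L[ℂ] Modes n) : ℂ :=
  ∑' i, inner ℂ (basis n i) (T (basis n i))

/-- Density operators of `n` modes: positive operators of trace one. -/
structure State (n : ℕ) where
  op : Modes n →L[ℂ] Modes n
  pos : op.IsPositive
  trace_one : HasSum (fun i => inner ℂ (basis n i) (op (basis n i))) 1

/-- The quantum characteristic function `χ(a, b) = tr(ρ W(a, b))`. -/
def charFn {n : ℕ} (ħ : ℝ) (ρ : State n) (a b : Conf n) : ℂ :=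
  trace (ρ.op ∘L weyl ħ a b)

/-- Gaussian states: the characteristic function is Gaussian,
`χ(ξ) = exp(i d·ξ - ξ·Vξ / 2)`, with displacement `d` and a real symmetric covariance matrix `V`
over the `2n` quadratures `(X₁, …, Xₙ, P₁, …, Pₙ)`. -/
def IsGaussian {n : ℕ} (ħ : ℝ) (ρ : State n) : Prop :=
  ∃ (d : Fin n ⊕ Fin n → ℝ) (V : Matrix (Fin n ⊕ Fin n) (Fin n ⊕ Fin n) ℝ), V.IsSymm ∧
    ∀ a b : Conf n, charFn ħ ρ a b =
      Complex.exp (Complex.I * ((d ⬝ᵥ Sum.elim a b : ℝ) : ℂ) -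
        ((Sum.elim a b ⬝ᵥ V.mulVec (Sum.elim a b) : ℝ) : ℂ) / 2)

/-- Possibly continuous convex combinations of Gaussian states, `ρ = ∫ ρ^y dν(y)` (as a weak
integral) for a probability measure `ν` on some measurable space and Gaussian states `ρ^y`. -/
def IsGaussianMixture {n : ℕ} (ħ : ℝ) (ρ : State n) : Prop :=
  ∃ (Y : Type u) (_ : MeasurableSpace Y) (ν : Measure Y) (σ : Y → State n),
    IsProbabilityMeasure ν ∧ (∀ y, IsGaussian ħ (σ y)) ∧
    ∀ φ ψ : Modes n, Integrable (fun y => inner ℂ φ ((σ y).op ψ)) ν ∧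
      inner ℂ φ (ρ.op ψ) = ∫ y, inner ℂ φ ((σ y).op ψ) ∂ν

/-! ### Coarse-grained quadrature measurements -/

/-- A partition of `ℝ` into intervals of constant length `δ`, indexed by `ℕ`. -/
structure Binning (δ : ℝ) where
  bin : ℕ → Set ℝ
  ordConnected : ∀ k, (bin k).OrdConnected
  disjoint : Pairwise fun k l => Disjoint (bin k) (bin l)
  cover : ⋃ k, bin k = Set.univ
  length : ∀ k, volume (bin k) = ENNReal.ofReal δ

/-- The vectors whose `i`-th coordinate lies in bin `z i` for every mode `i` with `θ i = c`. -/
def cell {n : ℕ} {δ : ℝ} (I : Binning δ) (θ : Fin n → Bool) (c : Bool) (z : Fin n → ℕ) :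
    Set (Conf n) :=
  {x | ∀ i, θ i = c → x i ∈ I.bin (z i)}

theorem measurableSet_cell {n : ℕ} {δ : ℝ} (I : Binning δ) (θ : Fin n → Bool) (c : Bool)
    (z : Fin n → ℕ) : MeasurableSet (cell I θ c z) := by
  have h : cell I θ c z = ⋂ i, ⋂ (_ : θ i = c), (fun x : Conf n => x i) ⁻¹' I.bin (z i) := by
    ext x; simp [cell]
  rw [h]
  refine MeasurableSet.iInter fun i => MeasurableSet.iInter fun _ => ?_
  have hm : Measurable fun x : Conf n => x i := by fun_prop
  exact hm (I.ordConnected (z i)).measurableSet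

/-- The effect of the outcome string `z` when mode `i` is subjected to the coarse-grained position
measurement (`θ i = false`) or the coarse-grained momentum measurement (`θ i = true`): the product
of the spectral projections of the measured quadratures, which commute since they belong to
different modes. -/
def effect {n : ℕ} (ħ : ℝ) {δx δp : ℝ} (I : Binning δx) (J : Binning δp)
    (θ : Fin n → Bool) (z : Fin n → ℕ) : Modes n →L[ℂ] Modes n :=
  posProj (cell I θ false z) (measurableSet_cell I θ false z) ∘L
    momProj ħ (cell J θ true z) (measurableSet_cell J θ true z)

/-- Born's rule: the probability `tr(ρ E)` of the outcome string `z` given the basis string `θ`. -/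
def outcomeProb {n : ℕ} (ħ : ℝ) {δx δp : ℝ} (I : Binning δx) (J : Binning δp)
    (ρ : State n) (θ : Fin n → Bool) (z : Fin n → ℕ) : ℝ :=
  (trace (ρ.op ∘L effect ħ I J θ z)).re

/-- Joint distribution of the outcomes `Z` and the uniformly distributed bases `θ`. -/
def outcomeDist {n : ℕ} (ħ : ℝ) {δx δp : ℝ} (I : Binning δx) (J : Binning δp)
    (ρ : State n) : (Fin n → ℕ) × (Fin n → Bool) → ℝ :=
  fun w => (1 / 2 : ℝ) ^ n * outcomeProb ħ I J ρ w.2 w.1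

/-- Joint distribution of `Z` and `(θ, K)`, where `K` has law `κ`, the state is `ρ k` given
`K = k`, and the bases `θ` are uniform and independent of `K`. -/
def outcomeDistSide {n : ℕ} {K : Type v} (ħ : ℝ) {δx δp : ℝ} (I : Binning δx)
    (J : Binning δp) (κ : PMF K) (ρ : K → State n) :
    (Fin n → ℕ) × ((Fin n → Bool) × K) → ℝ :=
  fun w => (κ w.2.2).toReal * ((1 / 2 : ℝ) ^ n * outcomeProb ħ I J (ρ w.2.2) w.2.1 w.1)

/-! ### Entropies of discrete distributions (logarithms to base two) -/

/-- Conditional `α`-Rényi entropy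
`H_α(Z|Y) = (1 / (1 - α)) log ∑_{z,y} p(z,y)^α p(y)^(1-α)`. -/
def condRenyi {Z : Type*} {Y : Type*} (α : ℝ) (p : Z × Y → ℝ) : ℝ :=
  1 / (1 - α) *
    Real.logb 2 (∑' w : Z × Y, p w ^ α * (∑' z : Z, p (z, w.2)) ^ (1 - α))

/-- The maximal probability of guessing `Z` correctly from `Y`, over all randomized strategies
`e(z|y)` (the diagonal parts of POVMs on the classical system `Y`). -/
def guessProb {Z : Type*} {Y : Type*} (q : PMF (Z × Y)) : ℝ :=
  ⨆ e : Y → PMF Z, ∑' w : Z × Y, (q w).toReal * (e w.2 w.1).toReal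

/-- Conditional min-entropy `H_min(Z|Y)`. -/
def minEntropy {Z : Type*} {Y : Type*} (q : PMF (Z × Y)) : ℝ :=
  -Real.logb 2 (guessProb q)

/-- Purified distance `√(1 - F)` with the fidelity `F = (∑ √p √q)²`. -/
def purifiedDist {W : Type*} (p : W → ℝ) (q : PMF W) : ℝ :=
  Real.sqrt (1 - (∑' w, Real.sqrt (p w) * Real.sqrt (q w).toReal) ^ 2)

/-- Smooth conditional min-entropy: the supremum of the min-entropy over all distributions that
are `ε`-close in purified distance. The supremum is taken in the extended reals. -/
def smoothMinEntropy {Z : Type*} {Y : Type*} (ε : ℝ) (p : Z × Y → ℝ) : EReal :=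
  ⨆ (q : PMF (Z × Y)) (_ : purifiedDist p q ≤ ε), ((minEntropy q : ℝ) : EReal)

/-! ### The bounds -/

/-- `B^α_Gauss(δx, δp) = (1 / (1 - α)) log (½ (1 + (1 / α) (δx δp / (π ħ))^(α - 1)))`. -/
def gaussBound (ħ δx δp α : ℝ) : ℝ :=
  1 / (1 - α) *
    Real.logb 2 (1 / 2 * (1 + 1 / α * (δx * δp / (Real.pi * ħ)) ^ (α - 1)))

/-- `λ^ε_Gauss(δx, δp, n) = sup_{1 < α ≤ 2} (B^α_Gauss - (1 / (n (α - 1))) log (2 / ε²))`. -/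
def gaussRate (ħ δx δp ε : ℝ) (n : ℕ) : ℝ :=
  ⨆ α : Set.Ioc (1 : ℝ) 2,
    (gaussBound ħ δx δp α - 1 / (n * ((α : ℝ) - 1)) * Real.logb 2 (2 / ε ^ 2))

/-- `c(δx, δp) = δx δp / (π e ħ)`. -/
def overlap (ħ δx δp : ℝ) : ℝ := δx * δp / (Real.pi * Real.exp 1 * ħ)

end CVGauss

end

/-!
A Gaussian state yields Gaussian outcomes. For a fixed choice of bases the measured quadratures
commute, and `trace_posProj_momProj` identifies their joint law with the Gaussian measure that has
the characteristic function of the state: a complex density is determined by its integrals against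
characters (`integral_eq_of_character`), which is applied to the position spectral projections
and then to the momentum ones. In this way neither a partial Fourier transform nor the
commutation of the projections is needed. Positivity of the state on Weyl operators of small argument
gives Robertson's relation `ħ² ω(u, w)² ≤ 4 V(u, u) V(w, w)` for the covariance form
(`sq_le_covForm_mul_covForm`).

For one mode with variances `s` and `s'`, Jensen's inequality on the bins bounds the power sums
`∑ p^α` of the two outcomes by numbers `a, b ≤ 1` with
`a b ≤ (1 / α) (δx δp / (π ħ))^(α - 1)`, and `a + b ≤ 1 + a b`
(`min_one_add_min_one_le`). For several modes, condition on all modes but one: the conditional law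
of the remaining quadrature is Gaussian, with the variance of its projection orthogonal to the
quadratures conditioned on. Those commute with the removed mode, so the two conditional variances
still obey the uncertainty relation, and the bound factorises over the modes by induction
(`sum_tsum_box_rpow_le`). Convexity of `x ↦ x^α` extends it to mixtures
(`IsGaussianMixture.outcomeProb_bounds`).

The smooth min-entropy is controlled by the power sum (`neg_logb_le_smoothMinEntropy`):
by Markov's inequality conditional probabilities above a suitable level carry little mass, which is
cut off and spread over the infinitely many other outcomes. The asymptotic values follow from the
derivative at `α = 1`, from `B^α ≤ -½ log c` (`gaussBound_le`), and from the choice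
`α = 1 + 1 / √n`.
-/

namespace CVGauss

/-! ### Traces against a state -/

section Hilbert

variable {H : Type*} [NormedAddCommGroup H] [InnerProductSpace ℂ H]
  {ι : Type*} (b : HilbertBasis ι ℂ H)

theorem hasSum_norm_inner_sq (x : H) : HasSum (fun i => ‖inner ℂ (b i) x‖ ^ 2) (‖x‖ ^ 2) := by
  have h := b.hasSum_inner_mul_inner x x
  rw [inner_self_eq_norm_sq_to_K] at h
  have h' := Complex.hasSum_re h
  convert h' using 1
  · ext i
    rw [← inner_conj_symm x, ← Complex.normSq_eq_conj_mul_self, Complex.ofReal_re,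
      Complex.normSq_eq_norm_sq]
  · norm_cast

/-- A factorisation `T = S† S` of a positive operator. -/
theorem exists_eq_adjoint_comp [CompleteSpace H] {T : H →L[ℂ] H} (hT : T.IsPositive) :
    ∃ S : H →L[ℂ] H, T = ContinuousLinearMap.adjoint S ∘L S := by
  have h : 0 ≤ T := (ContinuousLinearMap.nonneg_iff_isPositive _).2 hT
  obtain ⟨S, hS⟩ := CStarAlgebra.nonneg_iff_eq_star_mul_self.1 h
  exact ⟨S, hS⟩

variable {b} in
/-- The Hilbert–Schmidt norm does not change under adjoints. -/
theorem hasSum_norm_sq_adjoint [CompleteSpace H] {S : H →L[ℂ] H} {c : ℝ} (h : HasSum (fun i => ‖S (b i)‖ ^ 2) c) :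
    HasSum (fun j => ‖ContinuousLinearMap.adjoint S (b j)‖ ^ 2) c ∧
      Summable fun p : ι × ι => ‖inner ℂ (b p.2) (S (b p.1))‖ ^ 2 := by
  set F : ι × ι → ℝ := fun p => ‖inner ℂ (b p.2) (S (b p.1))‖ ^ 2
  have hF : Summable F := by
    refine (summable_prod_of_nonneg fun p => by positivity).2 ⟨fun i =>
      (hasSum_norm_inner_sq b (S (b i))).summable, ?_⟩
    convert h.summable using 2 with i
    exact (hasSum_norm_inner_sq b (S (b i))).tsum_eq
  refine ⟨?_, hF⟩
  have hc : HasSum F c := by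
    convert hF.hasSum
    rw [hF.tsum_prod, ← h.tsum_eq]
    exact tsum_congr fun i => (hasSum_norm_inner_sq b (S (b i))).tsum_eq.symm
  have hs : HasSum (F ∘ Prod.swap) c := (Equiv.prodComm _ _).hasSum_iff.2 hc
  refine hs.prod_fiberwise fun j => ?_
  convert hasSum_norm_inner_sq b (ContinuousLinearMap.adjoint S (b j)) using 2 with i
  simp only [F, Function.comp, Prod.swap, ContinuousLinearMap.adjoint_inner_right]
  rw [← norm_inner_symm]

theorem norm_inner_le_half (x y : H) : ‖inner ℂ x y‖ ≤ 1 / 2 * (‖x‖ ^ 2 + ‖y‖ ^ 2) := by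
  have := norm_inner_le_norm (𝕜 := ℂ) x y
  nlinarith [sq_nonneg (‖x‖ - ‖y‖)]

variable {b} in
theorem hasSum_norm_sq_of_factor [CompleteSpace H] {T S : H →L[ℂ] H} (hS : T = ContinuousLinearMap.adjoint S ∘L S)
    (h1 : HasSum (fun i => inner ℂ (b i) (T (b i))) 1) :
    HasSum (fun i => ‖S (b i)‖ ^ 2) 1 := by
  have h := Complex.hasSum_re h1
  rw [Complex.one_re] at h
  convert h using 2 with i
  rw [hS, ContinuousLinearMap.comp_apply, ContinuousLinearMap.adjoint_inner_right,
    inner_self_eq_norm_sq_to_K]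
  norm_cast

/-- Cyclicity of the trace: a density operator `T` is a mixture of (unnormalised) vectors `ψ j`,
in the sense that `tr(T A) = ∑ ⟨ψ j, A ψ j⟩` for every bounded operator `A`. The vectors are
`ψ j = S† e j` for a factorisation `T = S† S`. -/
theorem exists_vectors_of_isPositive [CompleteSpace H] {T : H →L[ℂ] H} (hT : T.IsPositive)
    (hT1 : HasSum (fun i => inner ℂ (b i) (T (b i))) 1) :
    ∃ ψ : ι → H, HasSum (fun j => ‖ψ j‖ ^ 2) 1 ∧
      ∀ A : H →L[ℂ] H,
        ∑' i, inner ℂ (b i) (T (A (b i))) = ∑' j, inner ℂ (ψ j) (A (ψ j)) := by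
  obtain ⟨S, hS⟩ := exists_eq_adjoint_comp hT
  obtain ⟨h2, hF⟩ := hasSum_norm_sq_adjoint (hasSum_norm_sq_of_factor hS hT1)
  refine ⟨fun j => ContinuousLinearMap.adjoint S (b j), h2, fun A => ?_⟩
  have h3 : Summable fun j =>
      ‖(ContinuousLinearMap.adjoint A ∘L ContinuousLinearMap.adjoint S) (b j)‖ ^ 2 := by
    refine Summable.of_nonneg_of_le (fun _ => by positivity) (fun j => ?_)
      (h2.summable.mul_left (‖ContinuousLinearMap.adjoint A‖ ^ 2))
    rw [ContinuousLinearMap.comp_apply, ← mul_pow]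
    gcongr
    exact ContinuousLinearMap.le_opNorm _ _
  obtain ⟨-, hG⟩ := hasSum_norm_sq_adjoint h3.hasSum
  have hG' := (Equiv.prodComm ι ι).summable_iff.2 hG
  set F : ι × ι → ℂ := fun p =>
    inner ℂ (S (b p.1)) (b p.2) * inner ℂ (b p.2) (S (A (b p.1)))
  have hFs : Summable F := by
    refine Summable.of_norm_bounded ((hF.add hG').mul_left (1 / 2)) fun p => ?_
    have e : ‖inner ℂ (b p.1) ((ContinuousLinearMap.adjoint A ∘L
        ContinuousLinearMap.adjoint S) (b p.2))‖ = ‖inner ℂ (b p.2) (S (A (b p.1)))‖ := by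
      rw [ContinuousLinearMap.comp_apply, ContinuousLinearMap.adjoint_inner_right,
        ContinuousLinearMap.adjoint_inner_right, norm_inner_symm]
    change ‖inner ℂ (S (b p.1)) (b p.2) * inner ℂ (b p.2) (S (A (b p.1)))‖ ≤
      1 / 2 * (‖inner ℂ (b p.2) (S (b p.1))‖ ^ 2 + ‖inner ℂ (b p.1) ((ContinuousLinearMap.adjoint A
        ∘L ContinuousLinearMap.adjoint S) (b p.2))‖ ^ 2)
    rw [e, norm_mul]
    rw [norm_inner_symm (S _)]
    nlinarith [sq_nonneg (‖inner ℂ (b p.2) (S (b p.1))‖ - ‖inner ℂ (b p.2) (S (A (b p.1)))‖)]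
  have e1 : ∑' i, inner ℂ (b i) (T (A (b i))) = ∑' i, ∑' j, F (i, j) := by
    refine tsum_congr fun i => ?_
    rw [hS, ContinuousLinearMap.comp_apply, ContinuousLinearMap.adjoint_inner_right]
    exact (b.hasSum_inner_mul_inner _ _).tsum_eq.symm
  rw [e1, ← Summable.tsum_comm (f := fun i j => F (i, j)) hFs]
  refine tsum_congr fun j => ?_
  change _ = inner ℂ (ContinuousLinearMap.adjoint S (b j)) (A (ContinuousLinearMap.adjoint S (b j)))
  rw [← ContinuousLinearMap.adjoint_inner_left, ← (b.hasSum_inner_mul_inner _ _).tsum_eq]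
  refine tsum_congr fun i => ?_
  simp only [F]
  rw [ContinuousLinearMap.adjoint_inner_left, ContinuousLinearMap.adjoint_inner_left,
    ContinuousLinearMap.adjoint_inner_right, mul_comm]

/-- The terms of `tr(T A)` in a fixed basis are absolutely summable, with a bound that does not
depend on the density operator `T`. -/
theorem sum_norm_inner_le_of_isPositive [CompleteSpace H] {T : H →L[ℂ] H} (hT : T.IsPositive)
    (hT1 : HasSum (fun i => inner ℂ (b i) (T (b i))) 1) (A : H →L[ℂ] H) (s : Finset ι) :
    ∑ i ∈ s, ‖inner ℂ (b i) (T (A (b i)))‖ ≤ 1 / 2 * (1 + ‖A‖ ^ 2) := by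
  obtain ⟨S, hS⟩ := exists_eq_adjoint_comp hT
  have h1 := hasSum_norm_sq_of_factor hS hT1
  obtain ⟨h2, -⟩ := hasSum_norm_sq_adjoint h1
  have hle : ∀ j, ‖(ContinuousLinearMap.adjoint A ∘L ContinuousLinearMap.adjoint S) (b j)‖ ^ 2
      ≤ ‖A‖ ^ 2 * ‖ContinuousLinearMap.adjoint S (b j)‖ ^ 2 := by
    intro j
    rw [ContinuousLinearMap.comp_apply, ← mul_pow]
    gcongr
    refine (ContinuousLinearMap.le_opNorm _ _).trans_eq ?_
    rw [LinearIsometryEquiv.norm_map]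
  have h3 := Summable.of_nonneg_of_le (fun _ => by positivity) hle (h2.summable.mul_left _)
  have h4 := (h3.tsum_le_tsum hle (h2.summable.mul_left _))
  rw [tsum_mul_left, h2.tsum_eq, mul_one] at h4
  obtain ⟨h5, -⟩ := hasSum_norm_sq_adjoint h3.hasSum
  have e5 : ContinuousLinearMap.adjoint (ContinuousLinearMap.adjoint A ∘L
      ContinuousLinearMap.adjoint S) = S ∘L A := by
    rw [ContinuousLinearMap.adjoint_comp, ContinuousLinearMap.adjoint_adjoint,
      ContinuousLinearMap.adjoint_adjoint]
  rw [e5] at h5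
  calc ∑ i ∈ s, ‖inner ℂ (b i) (T (A (b i)))‖
      ≤ ∑ i ∈ s, 1 / 2 * (‖S (b i)‖ ^ 2 + ‖(S ∘L A) (b i)‖ ^ 2) := by
        refine Finset.sum_le_sum fun i _ => ?_
        rw [hS, ContinuousLinearMap.comp_apply, ContinuousLinearMap.adjoint_inner_right]
        exact norm_inner_le_half _ _
    _ ≤ 1 / 2 * (1 + ‖A‖ ^ 2) := by
        rw [← Finset.mul_sum, Finset.sum_add_distrib]
        gcongr
        · exact sum_le_hasSum s (fun _ _ => by positivity) h1
        · exact (sum_le_hasSum s (fun _ _ => by positivity) h5).trans h4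

theorem countable_of_hilbertBasis (b : HilbertBasis ι ℂ H) [SecondCountableTopology H] : Countable ι := by
  have hd : ∀ i j : ι, i ≠ j → 1 ≤ dist (b i) (b j) := by
    intro i j hij
    rw [dist_eq_norm]
    have h2 : ‖b i - b j‖ ^ 2 = 2 := by
      rw [@norm_sub_sq ℂ, b.orthonormal.1 i, b.orthonormal.1 j, b.orthonormal.2 hij]
      norm_num
    nlinarith [norm_nonneg (b i - b j)]
  refine Set.countable_univ_iff.1 ?_
  refine Set.PairwiseDisjoint.countable_of_isOpen
    (s := fun i : ι => Metric.ball (b i) (1 / 2)) ?_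
    (fun _ _ => Metric.isOpen_ball) (fun i _ => ⟨b i, by simp⟩)
  intro i _ j _ hij
  refine Metric.ball_disjoint_ball ?_
  linarith [hd i j hij]

end Hilbert

instance countable_basisIndex (n : ℕ) : Countable (basisIndex n) :=
  haveI : Fact ((2 : ℝ≥0∞) ≠ ∞) := ⟨by norm_num⟩
  countable_of_hilbertBasis (basis n)

theorem State.exists_vectors {n : ℕ} (ρ : State n) :
    ∃ ψ : basisIndex n → Modes n, HasSum (fun j => ‖ψ j‖ ^ 2) 1 ∧
      ∀ A : Modes n →L[ℂ] Modes n, trace (ρ.op ∘L A) = ∑' j, inner ℂ (ψ j) (A (ψ j)) :=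
  exists_vectors_of_isPositive (basis n) ρ.pos ρ.trace_one

/-! ### Multiplication, translation and Fourier operators on `L²(ℝⁿ)` -/

theorem coeFn_mulOp {n : ℕ} (f : Conf n → ℂ) (hf : Measurable f) (hb : ∀ x, ‖f x‖ ≤ 1)
    (ψ : Modes n) : ⇑(mulOp f hf hb ψ) =ᵐ[volume] fun x => f x * ψ x := by
  have h1 := (ContinuousLinearMap.mul ℂ ℂ).coeFn_holder (r := 2)
    ((memLp_top_of_bdd hf hb).toLp f) ψ
  have h2 := (memLp_top_of_bdd hf hb).coeFn_toLp
  filter_upwards [h1, h2] with x h1 h2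
  refine Eq.trans h1 ?_
  rw [h2]
  rfl

theorem coeFn_translation {n : ℕ} (c : Conf n) (ψ : Modes n) :
    ⇑(translation c ψ) =ᵐ[volume] fun x => ψ (x + c) :=
  Lp.coeFn_compMeasurePreserving ψ (measurePreserving_add_right volume c)

theorem coeFn_weyl {n : ℕ} (ħ : ℝ) (a b : Conf n) (ψ : Modes n) :
    ⇑(weyl ħ a b ψ) =ᵐ[volume] fun x => weylPhase ħ a b x * ψ (x + ħ • b) := by
  filter_upwards [coeFn_mulOp (weylPhase ħ a b) (measurable_weylPhase ħ a b)
    (norm_weylPhase_le ħ a b) (translation (ħ • b) ψ), coeFn_translation (ħ • b) ψ] with x h1 h2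
  refine Eq.trans h1 ?_
  rw [h2]

theorem inner_eq_integral {n : ℕ} (φ ψ : Modes n) :
    inner ℂ φ ψ = ∫ x, starRingEnd ℂ (φ x) * ψ x := by
  rw [L2.inner_def]
  refine integral_congr_ae (Eventually.of_forall fun x => ?_)
  simp [mul_comm]

theorem integrable_conj_mul {n : ℕ} (φ ψ : Modes n) :
    Integrable (fun x => starRingEnd ℂ (φ x) * ψ x) := by
  refine (L2.integrable_inner (𝕜 := ℂ) φ ψ).congr (Eventually.of_forall fun x => ?_)
  simp [mul_comm]

theorem inner_mulOp {n : ℕ} (f : Conf n → ℂ) (hf : Measurable f) (hb : ∀ x, ‖f x‖ ≤ 1)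
    (φ ψ : Modes n) :
    inner ℂ φ (mulOp f hf hb ψ) = ∫ x, f x * (starRingEnd ℂ (φ x) * ψ x) := by
  rw [inner_eq_integral]
  refine integral_congr_ae ?_
  filter_upwards [coeFn_mulOp f hf hb ψ] with x hx
  rw [hx]
  ring

theorem norm_mulOp_le {n : ℕ} (f : Conf n → ℂ) (hf : Measurable f) (hb : ∀ x, ‖f x‖ ≤ 1)
    (ψ : Modes n) : ‖mulOp f hf hb ψ‖ ≤ ‖ψ‖ := by
  refine Lp.norm_le_norm_of_ae_le ?_
  filter_upwards [coeFn_mulOp f hf hb ψ] with x hx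
  rw [hx, norm_mul]
  exact mul_le_of_le_one_left (norm_nonneg _) (hb x)

theorem norm_translation {n : ℕ} (c : Conf n) (ψ : Modes n) : ‖translation c ψ‖ = ‖ψ‖ :=
  LinearIsometry.norm_map _ ψ

theorem norm_weyl_le {n : ℕ} (ħ : ℝ) (a b : Conf n) (ψ : Modes n) : ‖weyl ħ a b ψ‖ ≤ ‖ψ‖ :=
  (norm_mulOp_le _ (measurable_weylPhase ħ a b) (norm_weylPhase_le ħ a b) _).trans
    (norm_translation _ _).le

/-- The integral of `|φ̄ ψ|` is at most `‖φ‖ ‖ψ‖`, in a linearised form. -/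
theorem integral_norm_conj_mul_le {n : ℕ} (φ ψ : Modes n) :
    ∫ x, ‖starRingEnd ℂ (φ x) * ψ x‖ ≤ 1 / 2 * (‖φ‖ ^ 2 + ‖ψ‖ ^ 2) := by
  have key : ∀ χ : Modes n, Integrable (fun x => ‖χ x‖ ^ 2) ∧ ∫ x, ‖χ x‖ ^ 2 = ‖χ‖ ^ 2 := by
    intro χ
    have h := integrable_conj_mul χ χ
    have e : ∀ x, starRingEnd ℂ (χ x) * χ x = ((‖χ x‖ ^ 2 : ℝ) : ℂ) := fun x => by
      rw [Complex.conj_mul']; norm_cast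
    simp_rw [e] at h
    have h' : Integrable (fun x => ‖χ x‖ ^ 2) := h.re.congr (Eventually.of_forall fun x => Complex.ofReal_re _)
    refine ⟨h', ?_⟩
    have h2 := inner_eq_integral χ χ
    simp_rw [e] at h2
    rw [inner_self_eq_norm_sq_to_K, integral_complex_ofReal] at h2
    exact (RCLike.ofReal_injective (K := ℂ) (by simpa using h2)).symm
  rw [← (key φ).2, ← (key ψ).2, ← integral_add (key φ).1 (key ψ).1, ← integral_const_mul]
  refine integral_mono (integrable_conj_mul φ ψ).norm
    (((key φ).1.add (key ψ).1).const_mul _) fun x => ?_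
  simp only [norm_mul, RCLike.norm_conj]
  nlinarith [sq_nonneg (‖φ x‖ - ‖ψ x‖)]

/-- The character `ξ ↦ exp(i ⟨c, ξ⟩)`. -/
noncomputable def character {n : ℕ} (c ξ : Conf n) : ℂ := Complex.exp (Complex.I * (inner ℝ c ξ : ℝ))

theorem measurable_character {n : ℕ} (c : Conf n) : Measurable (character c) := by
  have : Continuous (character c) := by
    unfold character
    fun_prop
  exact this.measurable

theorem norm_character_le {n : ℕ} (c ξ : Conf n) : ‖character c ξ‖ ≤ 1 := by
  unfold character
  rw [mul_comm, Complex.norm_exp_ofReal_mul_I]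

theorem fourier_comp_add_right {n : ℕ} (f : Conf n → ℂ) (c ξ : Conf n) :
    𝓕 (fun x => f (x + c)) ξ = character ((2 * Real.pi) • c) ξ * 𝓕 f ξ := by
  have h := congrFun (VectorFourier.fourierIntegral_comp_add_right Real.fourierChar
    (volume : Measure (Conf n)) (innerₗ (Conf n)) f c) ξ
  refine Eq.trans h ?_
  rw [Circle.smul_def, smul_eq_mul, Real.fourierChar_apply]
  congr 1
  simp only [character, innerₗ_apply_apply, inner_smul_left]
  congr 1
  push_cast
  simp
  ring

theorem translation_toLp {n : ℕ} (c : Conf n) (f : SchwartzMap (Conf n) ℂ) :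
    translation c (f.toLp 2) = (f.compSubConstCLM ℂ (-c)).toLp 2 := by
  refine Lp.ext ?_
  have hf : (fun x => (f.toLp 2 : Modes n) (x + c)) =ᵐ[volume] fun x => f (x + c) :=
    (measurePreserving_add_right volume c).quasiMeasurePreserving.ae_eq_comp
      (f.coeFn_toLp 2 volume)
  filter_upwards [coeFn_translation c (f.toLp 2), hf,
    (f.compSubConstCLM ℂ (-c)).coeFn_toLp 2 volume] with x h1 h2 h3
  rw [h1, h2, h3]
  simp

theorem coeFn_fourier_toLp {n : ℕ} (f : SchwartzMap (Conf n) ℂ) :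
    ⇑(Lp.fourierTransformₗᵢ (Conf n) ℂ (f.toLp 2)) =ᵐ[volume] 𝓕 (f : Conf n → ℂ) := by
  have e : Lp.fourierTransformₗᵢ (Conf n) ℂ (f.toLp 2) =
      (𝓕 f : SchwartzMap (Conf n) ℂ).toLp 2 := SchwartzMap.toLp_fourier_eq f
  rw [e, ← SchwartzMap.fourier_coe]
  exact SchwartzMap.coeFn_toLp (𝓕 f : SchwartzMap (Conf n) ℂ) 2 (volume : Measure (Conf n))

/-- On the Fourier side, translations act as multiplication by a character. -/
theorem fourier_translation {n : ℕ} (c : Conf n) (ψ : Modes n) :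
    Lp.fourierTransformₗᵢ (Conf n) ℂ (translation c ψ) =
      mulOp (character ((2 * Real.pi) • c)) (measurable_character _) (norm_character_le _)
        (Lp.fourierTransformₗᵢ (Conf n) ℂ ψ) := by
  refine DenseRange.induction_on (p := fun ψ : Modes n =>
    Lp.fourierTransformₗᵢ (Conf n) ℂ (translation c ψ) =
      mulOp (character ((2 * Real.pi) • c)) (measurable_character _) (norm_character_le _)
        (Lp.fourierTransformₗᵢ (Conf n) ℂ ψ))
    (SchwartzMap.denseRange_toLpCLM (p := 2) ENNReal.ofNat_ne_top) ψ
    (isClosed_eq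
      ((Lp.fourierTransformₗᵢ (Conf n) ℂ).continuous.comp (translation c).continuous)
      ((mulOp _ _ _).continuous.comp (Lp.fourierTransformₗᵢ (Conf n) ℂ).continuous))
    fun f => ?_
  rw [SchwartzMap.toLpCLM_apply, translation_toLp]
  refine Lp.ext ?_
  filter_upwards [coeFn_mulOp (character ((2 * Real.pi) • c)) (measurable_character _)
    (norm_character_le _) (Lp.fourierTransformₗᵢ (Conf n) ℂ (f.toLp 2)), coeFn_fourier_toLp f,
    coeFn_fourier_toLp (f.compSubConstCLM ℂ (-c))] with ξ h1 h2 h3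
  have e : ⇑(f.compSubConstCLM ℂ (-c)) = fun x => f (x + c) := by
    ext x
    simp
  rw [h1, h2, h3, ← fourier_comp_add_right, e]

/-! ### Uniqueness of complex densities with given characters -/

section Uniqueness

variable {Ω Ω' : Type*} [MeasurableSpace Ω] [MeasurableSpace Ω'] {n : ℕ}

/-- The distribution of `X` under the positive part of the signed density `w`. -/
noncomputable def posPartLaw (μ : Measure Ω) (X : Ω → Conf n) (w : Ω → ℝ) : Measure (Conf n) :=
  (μ.withDensity fun ω => ENNReal.ofReal (w ω)).map X

theorem isFiniteMeasure_posPartLaw {μ : Measure Ω} (X : Ω → Conf n) {w : Ω → ℝ}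
    (hw : Integrable w μ) : IsFiniteMeasure (posPartLaw μ X w) := by
  have := isFiniteMeasure_withDensity_ofReal hw.2
  unfold posPartLaw
  infer_instance

theorem integral_posPartLaw {μ : Measure Ω} {X : Ω → Conf n} (hX : Measurable X) {w : Ω → ℝ}
    (hw : Integrable w μ) {g : Conf n → ℂ} (hg : Measurable g) :
    ∫ x, g x ∂(posPartLaw μ X w) = ∫ ω, g (X ω) * ((max (w ω) 0 : ℝ) : ℂ) ∂μ := by
  unfold posPartLaw
  rw [integral_map hX.aemeasurable hg.aestronglyMeasurable,
    integral_withDensity_eq_integral_toReal_smul₀ hw.aemeasurable.ennreal_ofReal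
      (Eventually.of_forall fun _ => ENNReal.ofReal_lt_top)]
  refine integral_congr_ae (Eventually.of_forall fun ω => ?_)
  simp [ENNReal.toReal_ofReal', mul_comm]

theorem integrable_mul_of_bdd {μ : Measure Ω} {X : Ω → Conf n} (hX : Measurable X) {w : Ω → ℂ}
    (hw : Integrable w μ) {g : Conf n → ℂ} (hg : Measurable g) (hb : ∀ x, ‖g x‖ ≤ 1) :
    Integrable (fun ω => g (X ω) * w ω) μ :=
  hw.bdd_mul (hg.comp hX).aestronglyMeasurable (Eventually.of_forall fun ω => hb (X ω))

theorem integral_posPartLaw_sub {μ : Measure Ω} {X : Ω → Conf n} (hX : Measurable X) {w : Ω → ℝ}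
    (hw : Integrable w μ) {g : Conf n → ℂ} (hg : Measurable g) (hb : ∀ x, ‖g x‖ ≤ 1) :
    ∫ x, g x ∂(posPartLaw μ X w) - ∫ x, g x ∂(posPartLaw μ X (-w)) =
      ∫ ω, g (X ω) * (w ω : ℂ) ∂μ := by
  rw [integral_posPartLaw hX hw hg, integral_posPartLaw hX hw.neg hg, ← integral_sub]
  · refine integral_congr_ae (Eventually.of_forall fun ω => ?_)
    simp only [Pi.neg_apply]
    rw [← mul_sub, ← Complex.ofReal_sub]
    congr 2
    rcases le_total (w ω) 0 with h | h
    · simp [h]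
    · simp [h]
  · exact integrable_mul_of_bdd hX hw.pos_part.ofReal hg hb
  · exact integrable_mul_of_bdd hX hw.neg.pos_part.ofReal hg hb

theorem integral_add_measure_of_bdd {P Q : Measure (Conf n)} [IsFiniteMeasure P]
    [IsFiniteMeasure Q] {g : Conf n → ℂ} (hg : Measurable g) (hb : ∀ x, ‖g x‖ ≤ 1) :
    ∫ x, g x ∂(P + Q) = ∫ x, g x ∂P + ∫ x, g x ∂Q :=
  integral_add_measure
    (.of_bound hg.aestronglyMeasurable 1 (Eventually.of_forall hb))
    (.of_bound hg.aestronglyMeasurable 1 (Eventually.of_forall hb))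

theorem integral_eq_of_character_real {μ : Measure Ω} {μ' : Measure Ω'} {X : Ω → Conf n}
    {X' : Ω' → Conf n} (hX : Measurable X) (hX' : Measurable X') {w : Ω → ℝ} {w' : Ω' → ℝ}
    (hw : Integrable w μ) (hw' : Integrable w' μ')
    (h : ∀ t, ∫ ω, character t (X ω) * (w ω : ℂ) ∂μ = ∫ ω, character t (X' ω) * (w' ω : ℂ) ∂μ')
    {g : Conf n → ℂ} (hg : Measurable g) (hb : ∀ x, ‖g x‖ ≤ 1) :
    ∫ ω, g (X ω) * (w ω : ℂ) ∂μ = ∫ ω, g (X' ω) * (w' ω : ℂ) ∂μ' := by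
  have i1 := isFiniteMeasure_posPartLaw X hw
  have i2 := isFiniteMeasure_posPartLaw X hw.neg
  have i3 := isFiniteMeasure_posPartLaw X' hw'
  have i4 := isFiniteMeasure_posPartLaw X' hw'.neg
  have key : posPartLaw μ X w + posPartLaw μ' X' (-w') =
      posPartLaw μ' X' w' + posPartLaw μ X (-w) := by
    refine Measure.ext_of_charFun (funext fun t => ?_)
    have e : ∀ x : Conf n, Complex.exp (inner ℝ x t * Complex.I) = character t x := fun x => by
      rw [character, real_inner_comm, mul_comm]
    simp only [charFun_apply, e]
    rw [integral_add_measure_of_bdd (measurable_character t) (norm_character_le t),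
      integral_add_measure_of_bdd (measurable_character t) (norm_character_le t)]
    have h1 := integral_posPartLaw_sub hX hw (measurable_character t) (norm_character_le t)
    have h2 := integral_posPartLaw_sub hX' hw' (measurable_character t) (norm_character_le t)
    linear_combination h1 - h2 + h t
  have h1 := integral_posPartLaw_sub hX hw hg hb
  have h2 := integral_posPartLaw_sub hX' hw' hg hb
  have h3 := congrArg (fun P : Measure (Conf n) => ∫ x, g x ∂P) key
  rw [integral_add_measure_of_bdd hg hb, integral_add_measure_of_bdd hg hb] at h3
  linear_combination h2 - h1 + h3

theorem star_character (t x : Conf n) :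
    starRingEnd ℂ (character t x) = character (-t) x := by
  simp [character, ← Complex.exp_conj]

theorem integral_character_mul_re {μ : Measure Ω} {X : Ω → Conf n} (hX : Measurable X)
    {w : Ω → ℂ} (hw : Integrable w μ) (t : Conf n) :
    ∫ ω, character t (X ω) * ((w ω).re : ℂ) ∂μ =
      1 / 2 * (∫ ω, character t (X ω) * w ω ∂μ +
        starRingEnd ℂ (∫ ω, character (-t) (X ω) * w ω ∂μ)) := by
  have hc : Integrable (fun ω => starRingEnd ℂ (w ω)) μ :=
    (LinearIsometryEquiv.integrable_comp_iff Complex.conjLIE).2 hw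
  rw [← integral_conj, ← integral_add, ← integral_const_mul]
  · refine integral_congr_ae (Eventually.of_forall fun ω => ?_)
    simp only [map_mul, star_character, neg_neg]
    rw [← mul_add, Complex.add_conj]
    push_cast
    ring
  · exact integrable_mul_of_bdd hX hw (measurable_character t) (norm_character_le t)
  · simp only [map_mul, star_character, neg_neg]
    exact integrable_mul_of_bdd hX hc (measurable_character t) (norm_character_le t)

theorem integral_mul_eq_re_add_im {μ : Measure Ω} {X : Ω → Conf n} (hX : Measurable X)
    {w : Ω → ℂ} (hw : Integrable w μ) {g : Conf n → ℂ} (hg : Measurable g)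
    (hb : ∀ x, ‖g x‖ ≤ 1) :
    ∫ ω, g (X ω) * w ω ∂μ = ∫ ω, g (X ω) * ((RCLike.re (w ω) : ℝ) : ℂ) ∂μ +
      Complex.I * ∫ ω, g (X ω) * ((RCLike.re (-Complex.I * w ω) : ℝ) : ℂ) ∂μ := by
  rw [← integral_const_mul, ← integral_add]
  · refine integral_congr_ae (Eventually.of_forall fun ω => ?_)
    have e : w ω = (w ω).re + Complex.I * (w ω).im := by
      rw [mul_comm, Complex.re_add_im]
    simp only [RCLike.re_eq_complex_re]
    nth_rw 1 [e]
    simp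
    ring
  · exact integrable_mul_of_bdd hX hw.re.ofReal hg hb
  · exact (integrable_mul_of_bdd hX (hw.const_mul (-Complex.I)).re.ofReal hg hb).const_mul _

/-- Two complex densities whose integrals against all characters of the random variables `X` and
`X'` agree have the same integrals against all bounded functions of `X` and `X'`. -/
theorem integral_eq_of_character {μ : Measure Ω} {μ' : Measure Ω'} {X : Ω → Conf n}
    {X' : Ω' → Conf n} (hX : Measurable X) (hX' : Measurable X') {w : Ω → ℂ} {w' : Ω' → ℂ}
    (hw : Integrable w μ) (hw' : Integrable w' μ')
    (h : ∀ t, ∫ ω, character t (X ω) * w ω ∂μ = ∫ ω, character t (X' ω) * w' ω ∂μ')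
    {g : Conf n → ℂ} (hg : Measurable g) (hb : ∀ x, ‖g x‖ ≤ 1) :
    ∫ ω, g (X ω) * w ω ∂μ = ∫ ω, g (X' ω) * w' ω ∂μ' := by
  have hre := integral_eq_of_character_real hX hX' hw.re hw'.re (fun t => by
    refine (integral_character_mul_re hX hw t).trans (Eq.trans ?_
      (integral_character_mul_re hX' hw' t).symm)
    rw [h t, h (-t)]) hg hb
  have hI : Integrable (fun ω => -Complex.I * w ω) μ := hw.const_mul _
  have hI' : Integrable (fun ω => -Complex.I * w' ω) μ' := hw'.const_mul _
  have him := integral_eq_of_character_real hX hX' hI.re hI'.re (fun t => by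
    refine (integral_character_mul_re hX hI t).trans (Eq.trans ?_
      (integral_character_mul_re hX' hI' t).symm)
    simp only [mul_left_comm _ (-Complex.I), integral_const_mul]
    rw [h t, h (-t)]) hg hb
  rw [integral_mul_eq_re_add_im hX hw hg hb, integral_mul_eq_re_add_im hX' hw' hg hb, hre, him]

end Uniqueness

/-- The matrix elements `∑ ⟨φ j, f ψ j⟩` of multiplication operators are given by a density. -/
theorem exists_density {n : ℕ} {ι : Type*} (φ ψ : ι → Modes n)
    (hφ : Summable fun j => ‖φ j‖ ^ 2) (hψ : Summable fun j => ‖ψ j‖ ^ 2) :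
    ∃ w : Conf n → ℂ, Integrable w ∧ ∀ (f : Conf n → ℂ) (hf : Measurable f)
      (hb : ∀ x, ‖f x‖ ≤ 1), ∑' j, inner ℂ (φ j) (mulOp f hf hb (ψ j)) = ∫ x, f x * w x := by
  set u : ι → Conf n →₁[volume] ℂ := fun j => (integrable_conj_mul (φ j) (ψ j)).toL1
  have hu : Summable u := by
    refine Summable.of_norm_bounded ((hφ.add hψ).mul_left (1 / 2)) fun j => ?_
    refine le_trans (le_of_eq ?_) (integral_norm_conj_mul_le (φ j) (ψ j))
    rw [L1.norm_eq_integral_norm]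
    refine integral_congr_ae ?_
    filter_upwards [(integrable_conj_mul (φ j) (ψ j)).coeFn_toL1] with x hx
    rw [hx]
  refine ⟨(∑' j, u j : Conf n →₁[volume] ℂ), L1.integrable_coeFn _, fun f hf hb => ?_⟩
  set F := (memLp_top_of_bdd hf hb).toLp f
  have hF : ⇑F =ᵐ[volume] f := (memLp_top_of_bdd hf hb).coeFn_toLp
  have h := ((ContinuousLinearMap.mul ℂ ℂ).lpPairing volume ∞ 1 F).hasSum hu.hasSum
  have e : ∀ v : Conf n →₁[volume] ℂ,
      (ContinuousLinearMap.mul ℂ ℂ).lpPairing volume ∞ 1 F v = ∫ x, f x * v x := by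
    intro v
    rw [ContinuousLinearMap.lpPairing_eq_integral]
    refine integral_congr_ae ?_
    filter_upwards [hF] with x hx
    rw [hx]
    rfl
  rw [← e, ← h.tsum_eq]
  refine tsum_congr fun j => ?_
  rw [inner_mulOp, e]
  refine integral_congr_ae ?_
  filter_upwards [(integrable_conj_mul (φ j) (ψ j)).coeFn_toL1] with x hx
  rw [hx]

/-! ### The uncertainty relation for the covariance matrix -/

/-- The Weyl relations, `W(a, b)† W(a', b') = exp(iħ(a·b' - a'·b)/2) W(a' - a, b' - b)`. -/
theorem inner_weyl_weyl {n : ℕ} (ħ : ℝ) (a b a' b' : Conf n) (ψ φ : Modes n) :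
    inner ℂ (weyl ħ a b ψ) (weyl ħ a' b' φ) =
      Complex.exp (Complex.I * ((ħ * (inner ℝ a b' - inner ℝ a' b) / 2 : ℝ) : ℂ)) *
        inner ℂ ψ (weyl ħ (a' - a) (b' - b) φ) := by
  rw [inner_eq_integral, inner_eq_integral, ← integral_const_mul,
    ← integral_add_right_eq_self (fun x => _ * (starRingEnd ℂ _ * _)) (ħ • b)]
  refine integral_congr_ae ?_
  have h3 := (measurePreserving_add_right (volume : Measure (Conf n))
    (ħ • b)).quasiMeasurePreserving.ae_eq_comp (coeFn_weyl ħ (a' - a) (b' - b) φ)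
  filter_upwards [coeFn_weyl ħ a b ψ, coeFn_weyl ħ a' b' φ, h3] with x h1 h2 h3
  simp only [Function.comp] at h3
  rw [h1, h2, h3, map_mul]
  have e : x + ħ • b + ħ • (b' - b) = x + ħ • b' := by
    rw [smul_sub]
    abel
  have e2 : starRingEnd ℂ (weylPhase ħ a b x) * weylPhase ħ a' b' x =
      Complex.exp (Complex.I * ((ħ * (inner ℝ a b' - inner ℝ a' b) / 2 : ℝ) : ℂ)) *
        weylPhase ħ (a' - a) (b' - b) (x + ħ • b) := by
    unfold weylPhase
    rw [← Complex.exp_conj, ← Complex.exp_add, ← Complex.exp_add]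
    congr 1
    simp only [map_mul, Complex.conj_I, Complex.conj_ofReal, inner_sub_left, inner_sub_right,
      inner_add_right, inner_smul_right]
    push_cast
    ring
  rw [e]
  linear_combination (starRingEnd ℂ (ψ (x + ħ • b)) * φ (x + ħ • b')) * e2

theorem weyl_zero {n : ℕ} (ħ : ℝ) (ψ : Modes n) : weyl ħ 0 0 ψ = ψ := by
  refine Lp.ext ?_
  filter_upwards [coeFn_weyl ħ 0 0 ψ] with x hx
  rw [hx]
  simp [weylPhase]

theorem summable_inner_of_norm_le {H ι : Type*} [NormedAddCommGroup H] [InnerProductSpace ℂ H]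
    {ψ φ χ : ι → H} (hψ : Summable fun j => ‖ψ j‖ ^ 2)
    (hφ : ∀ j, ‖φ j‖ ≤ ‖ψ j‖) (hχ : ∀ j, ‖χ j‖ ≤ ‖ψ j‖) :
    Summable fun j => inner ℂ (φ j) (χ j) := by
  refine Summable.of_norm_bounded hψ fun j => (norm_inner_le_norm _ _).trans ?_
  rw [sq]
  exact mul_le_mul (hφ j) (hχ j) (norm_nonneg _) (norm_nonneg _)

/-- Positivity of the state on combinations of `c W(a, b) - 1` and `c' W(a', b') - 1`, written
through the characteristic function: if the phases `c`, `c'` make the expectations of the two Weyl operators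
equal to the real numbers `g`, `g'`, then the correlation of `c W(a, b) - 1` and
`c' W(a', b') - 1` is bounded by their second moments. -/
theorem State.correlation_le {n : ℕ} (ħ : ℝ) (ρ : State n) (a b a' b' : Conf n) (c c' : ℂ)
    (hc : ‖c‖ = 1) (hc' : ‖c'‖ = 1) {g g' : ℝ} (hg : c * charFn ħ ρ a b = g)
    (hg' : c' * charFn ħ ρ a' b' = g') (l : ℝ) :
    2 * l * (starRingEnd ℂ c * c' * (Complex.exp (Complex.I *
        ((ħ * (inner ℝ a b' - inner ℝ a' b) / 2 : ℝ) : ℂ)) * charFn ħ ρ (a' - a) (b' - b))).im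
      ≤ (2 - 2 * g) + l ^ 2 * (2 - 2 * g') := by
  obtain ⟨ψ, h1, hψ⟩ := ρ.exists_vectors
  set P : ℂ := Complex.exp (Complex.I * ((ħ * (inner ℝ a b' - inner ℝ a' b) / 2 : ℝ) : ℂ)) with hP
  have hn : ∀ j, ‖ψ j‖ ≤ ‖ψ j‖ := fun j => le_rfl
  -- expectations of Weyl operators as sums over the vectors of the state
  have hW : ∀ a b : Conf n, HasSum (fun j => inner ℂ (ψ j) (weyl ħ a b (ψ j))) (charFn ħ ρ a b) :=
    fun a b => by
      rw [charFn, hψ]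
      exact (summable_inner_of_norm_le h1.summable hn fun j => norm_weyl_le ħ a b _).hasSum
  have hself : ∀ j, inner ℂ (ψ j) (ψ j) = ((‖ψ j‖ ^ 2 : ℝ) : ℂ) := fun j => by
    rw [inner_self_eq_norm_sq_to_K]; norm_cast
  have h1' : HasSum (fun j => inner ℂ (ψ j) (ψ j)) 1 := by
    have h := Complex.hasSum_ofReal.2 h1
    rw [Complex.ofReal_one] at h
    simpa only [hself] using h
  have hWW : ∀ (a b : Conf n) j, ‖weyl ħ a b (ψ j)‖ ^ 2 = ‖ψ j‖ ^ 2 := fun a b j => by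
    have h := inner_weyl_weyl ħ a b a b (ψ j) (ψ j)
    rw [sub_self, sub_self, sub_self, weyl_zero, hself, inner_self_eq_norm_sq_to_K] at h
    simp at h
    exact_mod_cast h
  have key : ∀ (a b : Conf n) (c : ℂ) (g : ℝ), ‖c‖ = 1 → c * charFn ħ ρ a b = g →
      HasSum (fun j => ‖c • weyl ħ a b (ψ j) - ψ j‖ ^ 2) (2 - 2 * g) := by
    intro a b c g hc hg
    have h := ((h1.mul_left 2).sub (Complex.hasSum_re ((hW a b).mul_left (2 * c))))
    rw [mul_assoc, hg] at h
    have e : 2 * 1 - ((2 : ℂ) * (g : ℂ)).re = 2 - 2 * g := by simp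
    rw [e] at h
    refine h.congr_fun fun j => ?_
    rw [@norm_sub_sq ℂ, norm_smul, hc, one_mul, hWW, inner_smul_left, ← inner_conj_symm,
      ← map_mul, RCLike.conj_re]
    simp only [RCLike.re_eq_complex_re, mul_assoc, Complex.mul_re, Complex.re_ofNat,
      Complex.im_ofNat]
    ring
  have hA := key a b c g hc hg
  have hB := key a' b' c' g' hc' hg'
  have hAB : HasSum (fun j => inner ℂ (c • weyl ħ a b (ψ j) - ψ j)
      (c' • weyl ħ a' b' (ψ j) - ψ j))
      (starRingEnd ℂ c * c' * (P * charFn ħ ρ (a' - a) (b' - b)) - (g : ℂ) - (g' : ℂ) + 1) := by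
    have s1 := ((hW (a' - a) (b' - b)).mul_left P).mul_left (starRingEnd ℂ c * c')
    have s2 := Complex.hasSum_conj'.2 ((hW a b).mul_left c)
    have s3 := (hW a' b').mul_left c'
    rw [hg, Complex.conj_ofReal] at s2
    rw [hg'] at s3
    refine (((s1.sub s2).sub s3).add h1').congr_fun fun j => ?_
    rw [inner_sub_left, inner_sub_right, inner_sub_right, inner_smul_left, inner_smul_right,
      inner_smul_right, inner_smul_left, inner_weyl_weyl, map_mul, inner_conj_symm]
    ring
  have hIm := Complex.hasSum_im hAB
  have e : (starRingEnd ℂ c * c' * (P * charFn ħ ρ (a' - a) (b' - b)) - (g : ℂ) - (g' : ℂ)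
      + 1).im = (starRingEnd ℂ c * c' * (P * charFn ħ ρ (a' - a) (b' - b))).im := by
    simp
  rw [e] at hIm
  refine hasSum_le (fun j => ?_) (hIm.mul_left (2 * l)) (hA.add (hB.mul_left (l ^ 2)))
  set A := c • weyl ħ a b (ψ j) - ψ j
  set B := c' • weyl ħ a' b' (ψ j) - ψ j
  have hi : |(inner ℂ A B).im| ≤ ‖A‖ * ‖B‖ :=
    (Complex.abs_im_le_norm _).trans (norm_inner_le_norm _ _)
  have h2 : 2 * l * (inner ℂ A B).im ≤ 2 * |l| * (‖A‖ * ‖B‖) := by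
    calc 2 * l * (inner ℂ A B).im ≤ |2 * l * (inner ℂ A B).im| := le_abs_self _
      _ = 2 * |l| * |(inner ℂ A B).im| := by rw [abs_mul, abs_mul, abs_two]
      _ ≤ _ := by gcongr
  nlinarith [sq_nonneg (‖A‖ - |l| * ‖B‖), sq_abs l]

/-- The quadratic form of a covariance matrix at the quadrature `a·X + b·P`. -/
noncomputable def covForm {n : ℕ} (V : Matrix (Fin n ⊕ Fin n) (Fin n ⊕ Fin n) ℝ)
    (a b : Conf n) : ℝ :=
  Sum.elim a b ⬝ᵥ V.mulVec (Sum.elim a b)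

theorem sumElim_smul {n : ℕ} (t : ℝ) (a b : Conf n) :
    Sum.elim (t • a : Conf n) (t • b : Conf n) = t • Sum.elim (a : Fin n → ℝ) b := by
  ext i
  cases i <;> simp

theorem covForm_smul {n : ℕ} (V : Matrix (Fin n ⊕ Fin n) (Fin n ⊕ Fin n) ℝ) (t : ℝ)
    (a b : Conf n) : covForm V (t • a) (t • b) = t ^ 2 * covForm V a b := by
  simp only [covForm, sumElim_smul, Matrix.mulVec_smul, smul_dotProduct, dotProduct_smul,
    smul_eq_mul]
  ring

/-- Robertson's uncertainty relation for the quadratures `a·X + b·P` and `a'·X + b'·P` of a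
Gaussian state. It follows from the positivity of the state on Weyl operators of small argument. -/
theorem sq_le_covForm_mul_covForm {n : ℕ} {ħ : ℝ} {ρ : State n} {d : Fin n ⊕ Fin n → ℝ}
    {V : Matrix (Fin n ⊕ Fin n) (Fin n ⊕ Fin n) ℝ}
    (h : ∀ a b : Conf n, charFn ħ ρ a b =
      Complex.exp (Complex.I * ((d ⬝ᵥ Sum.elim a b : ℝ) : ℂ) - ((covForm V a b : ℝ) : ℂ) / 2))
    (a b a' b' : Conf n) :
    (ħ * (inner ℝ a b' - inner ℝ a' b)) ^ 2 ≤ 4 * covForm V a b * covForm V a' b' := by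
  set Ω := ħ * (inner ℝ a b' - inner ℝ a' b) with hΩ
  -- the inequality before the limit of small arguments
  have step : ∀ (l t : ℝ), 0 < t →
      2 * l * (Real.exp (-(t ^ 2 * covForm V (a' - a) (b' - b)) / 2) * Real.sin (t ^ 2 * Ω / 2))
        ≤ t ^ 2 * (covForm V a b + l ^ 2 * covForm V a' b') := by
    intro l t ht
    have ph : ∀ a b : Conf n, Complex.exp (-(Complex.I * ((d ⬝ᵥ Sum.elim a b : ℝ) : ℂ))) *
        charFn ħ ρ a b = ((Real.exp (-(covForm V a b) / 2) : ℝ) : ℂ) := fun a b => by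
      rw [h, ← Complex.exp_add, Complex.ofReal_exp]
      congr 1
      push_cast
      ring
    have nrm : ∀ x : ℝ, ‖Complex.exp (-(Complex.I * (x : ℂ)))‖ = 1 := fun x => by
      rw [← mul_neg, mul_comm, ← Complex.ofReal_neg, Complex.norm_exp_ofReal_mul_I]
    have hk := ρ.correlation_le ħ (t • a) (t • b) (t • a') (t • b') _ _ (nrm _) (nrm _)
      (ph (t • a) (t • b)) (ph (t • a') (t • b')) l
    have e1 : ħ * (inner ℝ (t • a) (t • b') - inner ℝ (t • a') (t • b)) / 2 = t ^ 2 * Ω / 2 := by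
      simp only [inner_smul_left, inner_smul_right, hΩ, RCLike.conj_to_real]
      ring
    have e2 : starRingEnd ℂ (Complex.exp (-(Complex.I * ((d ⬝ᵥ Sum.elim (t • a : Conf n)
        (t • b : Conf n) : ℝ) : ℂ)))) * Complex.exp (-(Complex.I * ((d ⬝ᵥ Sum.elim
        (t • a' : Conf n) (t • b' : Conf n) : ℝ) : ℂ))) *
        (Complex.exp (Complex.I * ((t ^ 2 * Ω / 2 : ℝ) : ℂ)) *
          charFn ħ ρ (t • a' - t • a) (t • b' - t • b)) =
        ((Real.exp (-(t ^ 2 * covForm V (a' - a) (b' - b)) / 2) : ℝ) : ℂ) *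
          Complex.exp (((t ^ 2 * Ω / 2 : ℝ) : ℂ) * Complex.I) := by
      rw [← smul_sub, ← smul_sub, h, covForm_smul, ← Complex.exp_conj, Complex.ofReal_exp]
      simp only [← Complex.exp_add]
      congr 1
      have e3 : Sum.elim (a' - a : Conf n) (b' - b : Conf n) =
          Sum.elim (a' : Fin n → ℝ) b' - Sum.elim (a : Fin n → ℝ) b := by
        ext i
        cases i <;> simp
      simp only [sumElim_smul, e3, dotProduct_smul, dotProduct_sub, map_neg, map_mul,
        Complex.conj_I, Complex.conj_ofReal, smul_eq_mul]
      push_cast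
      ring
    rw [e1, e2, Complex.im_ofReal_mul, Complex.exp_ofReal_mul_I_im, covForm_smul,
      covForm_smul] at hk
    have b1 := Real.add_one_le_exp (-(t ^ 2 * covForm V a b) / 2)
    have b2 := Real.add_one_le_exp (-(t ^ 2 * covForm V a' b') / 2)
    refine hk.trans ?_
    nlinarith [mul_le_mul_of_nonneg_left b2 (sq_nonneg l)]
  have lim : ∀ l : ℝ, l * Ω ≤ covForm V a b + l ^ 2 * covForm V a' b' := by
    intro l
    set D := covForm V (a' - a) (b' - b)
    have hd : HasDerivAt (fun s : ℝ => 2 * l * (Real.exp (-(s * D) / 2) * Real.sin (s * Ω / 2)))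
        (l * Ω) 0 := by
      have h1 : HasDerivAt (fun s : ℝ => Real.exp (-(s * D) / 2)) (-D / 2) 0 := by
        have := ((((hasDerivAt_id (0 : ℝ)).mul_const D).neg).div_const 2).exp
        simpa using this
      have h2 : HasDerivAt (fun s : ℝ => Real.sin (s * Ω / 2)) (Ω / 2) 0 := by
        have := (((hasDerivAt_id (0 : ℝ)).mul_const Ω).div_const 2).sin
        simpa using this
      refine ((h1.mul h2).const_mul (2 * l)).congr_deriv ?_
      simp
      ring
    refine le_of_tendsto hd.tendsto_slope_zero_right ?_
    filter_upwards [self_mem_nhdsWithin] with s hs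
    have hs' : 0 < s := hs
    have hk := step l (√s) (Real.sqrt_pos.2 hs')
    rw [Real.sq_sqrt hs'.le] at hk
    simp only [zero_add, zero_mul, zero_div, Real.sin_zero, mul_zero, sub_zero, smul_eq_mul]
    rw [inv_mul_le_iff₀ hs']
    exact hk
  have hdis := discrim_le_zero (a := covForm V a' b') (b := -Ω) (c := covForm V a b)
    fun l => by nlinarith [lim l]
  rw [discrim] at hdis
  nlinarith

/-! ### The joint law of the measured quadratures -/

/-- The vector `x` with the coordinates outside `{i | θ i = c}` set to zero. -/
noncomputable def mask {n : ℕ} (θ : Fin n → Bool) (c : Bool) (x : Conf n) : Conf n :=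
  WithLp.toLp 2 fun i => if θ i = c then x i else 0

@[simp]
theorem mask_apply {n : ℕ} (θ : Fin n → Bool) (c : Bool) (x : Conf n) (i : Fin n) :
    mask θ c x i = if θ i = c then x i else 0 := rfl

theorem measurable_mask {n : ℕ} (θ : Fin n → Bool) (c : Bool) : Measurable (mask θ c) := by
  have : Continuous (mask θ c) := by
    refine (PiLp.continuous_toLp 2 _).comp (continuous_pi fun i => ?_)
    by_cases h : θ i = c
    · simp only [h, if_true]
      fun_prop
    · simp only [h, if_false]
      fun_prop
  exact this.measurable

theorem inner_mask_left {n : ℕ} (θ : Fin n → Bool) (c : Bool) (t x : Conf n) :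
    inner ℝ (mask θ c t) x = inner ℝ t (mask θ c x) := by
  simp only [PiLp.inner_apply, mask_apply]
  refine Finset.sum_congr rfl fun i _ => ?_
  split_ifs <;> simp

theorem mask_mask {n : ℕ} (θ : Fin n → Bool) (c : Bool) (x : Conf n) :
    mask θ c (mask θ c x) = mask θ c x := by
  ext i
  simp only [mask_apply]
  split_ifs <;> rfl

theorem mask_mask_of_ne {n : ℕ} (θ : Fin n → Bool) {c c' : Bool} (h : c ≠ c') (x : Conf n) :
    mask θ c (mask θ c' x) = 0 := by
  ext i
  simp only [mask_apply, PiLp.zero_apply]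
  split_ifs with h1 h2
  · exact absurd (h1.symm.trans h2) h
  · rfl
  · rfl

theorem mask_add {n : ℕ} (θ : Fin n → Bool) (c : Bool) (x y : Conf n) :
    mask θ c (x + y) = mask θ c x + mask θ c y := by
  ext i
  simp only [mask_apply, PiLp.add_apply]
  split_ifs <;> simp

theorem character_mask {n : ℕ} (θ : Fin n → Bool) (c : Bool) (t x : Conf n) :
    character (mask θ c t) x = character t (mask θ c x) := by
  rw [character, character, inner_mask_left]

theorem character_add {n : ℕ} (s t x : Conf n) :
    character (s + t) x = character s x * character t x := by
  rw [character, character, character, ← Complex.exp_add, inner_add_left]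
  push_cast
  ring_nf

theorem mulOp_congr {n : ℕ} {f g : Conf n → ℂ} (hf : Measurable f) (hb : ∀ x, ‖f x‖ ≤ 1)
    (hg : Measurable g) (hb' : ∀ x, ‖g x‖ ≤ 1) (h : ∀ x, f x = g x) :
    mulOp f hf hb = mulOp g hg hb' := by
  obtain rfl : f = g := funext h
  rfl

/-- A Weyl operator of commuting position and momentum parts factorises without a phase. -/
theorem weyl_mask {n : ℕ} (ħ : ℝ) (θ : Fin n → Bool) (a b : Conf n) :
    weyl ħ (mask θ false a) (mask θ true b) =
      mulOp (character (mask θ false a)) (measurable_character _) (norm_character_le _) ∘L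
        translation (ħ • mask θ true b) := by
  unfold weyl
  congr 1
  refine mulOp_congr _ _ _ _ fun x => ?_
  rw [weylPhase, character, inner_mask_left θ false a (mask θ true b),
    mask_mask_of_ne θ (by decide), inner_zero_right]
  simp

theorem inner_posProj_left {n : ℕ} {s : Set (Conf n)} (hs : MeasurableSet s) (φ ψ : Modes n) :
    inner ℂ (posProj s hs φ) ψ = inner ℂ φ (posProj s hs ψ) := by
  rw [inner_eq_integral, inner_eq_integral]
  refine integral_congr_ae ?_
  filter_upwards [coeFn_mulOp _ (measurable_indicator_one hs) (norm_indicator_one_le s) φ,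
    coeFn_mulOp _ (measurable_indicator_one hs) (norm_indicator_one_le s) ψ] with x h1 h2
  rw [posProj, h1, h2]
  by_cases hx : x ∈ s <;> simp [hx]

/-- The phase space distribution of the measured quadratures: a finite measure with the
characteristic function of `ρ` on the span of the measured quadratures reproduces the outcome
probabilities. The position part and the momentum part are identified one after the other, as
densities of complex measures. -/
theorem trace_posProj_momProj {n : ℕ} {ħ : ℝ} (ρ : State n) (θ : Fin n → Bool)
    (N : Measure (Conf n)) [IsFiniteMeasure N]
    (hN : ∀ t, ∫ x, character t x ∂N = charFn ħ ρ (mask θ false t) (mask θ true t))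
    {A B : Set (Conf n)} (hA : MeasurableSet A) (hB : MeasurableSet B)
    (hAm : ∀ x, mask θ false x ∈ A ↔ x ∈ A) (hBm : ∀ x, mask θ true x ∈ B ↔ x ∈ B) :
    trace (ρ.op ∘L (posProj A hA ∘L momProj ħ B hB)) = (N.real (A ∩ B) : ℂ) := by
  obtain ⟨ψ, h1, hψ⟩ := ρ.exists_vectors
  have ind : ∀ (s : Set (Conf n)) (c : Bool) (_ : ∀ x, mask θ c x ∈ s ↔ x ∈ s) (x : Conf n),
      s.indicator (fun _ => (1 : ℂ)) (mask θ c x) = s.indicator (fun _ => 1) x := by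
    intro s c h x
    by_cases hx : x ∈ s
    · rw [Set.indicator_of_mem hx, Set.indicator_of_mem ((h x).2 hx)]
    · rw [Set.indicator_of_notMem hx, Set.indicator_of_notMem (mt (h x).1 hx)]
  -- the position part: identify the density of `⟨ψ, M_f T_b ψ⟩` for functions `f` of the positions
  have step : ∀ b : Conf n,
      ∑' j, inner ℂ (ψ j) (posProj A hA (translation (ħ • mask θ true b) (ψ j))) =
        ∫ x, A.indicator (fun _ => 1) x * character (mask θ true b) x ∂N := by
    intro b
    obtain ⟨w, hw, hwf⟩ := exists_density ψ (fun j => translation (ħ • mask θ true b) (ψ j))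
      h1.summable (by simpa only [norm_translation] using h1.summable)
    have hw' : Integrable (fun x => character (mask θ true b) x) N :=
      .of_bound (measurable_character _).aestronglyMeasurable 1
        (Eventually.of_forall fun x => norm_character_le _ x)
    have h := integral_eq_of_character (measurable_mask θ false) (measurable_mask θ false) hw hw'
      (fun t => by
        simp only [← character_mask]
        rw [← hwf _ (measurable_character _) (norm_character_le _)]
        simp only [← character_add]
        rw [hN, charFn, hψ, mask_add, mask_add, mask_mask, mask_mask,
          mask_mask_of_ne θ (show false ≠ true by decide),
          mask_mask_of_ne θ (show true ≠ false by decide), add_zero, zero_add, weyl_mask]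
        rfl) (measurable_indicator_one hA) (norm_indicator_one_le A)
    simp only [ind A false hAm] at h
    rw [← h, ← hwf _ (measurable_indicator_one hA) (norm_indicator_one_le A)]
    rfl
  -- the momentum part: identify the density of `⟨P_A ψ, f(P) ψ⟩` on the Fourier side
  set F := Lp.fourierTransformₗᵢ (Conf n) ℂ
  obtain ⟨w, hw, hwf⟩ := exists_density (fun j => F (posProj A hA (ψ j))) (fun j => F (ψ j))
    (by
      refine Summable.of_nonneg_of_le (fun _ => by positivity) (fun j => ?_) h1.summable
      rw [LinearIsometryEquiv.norm_map]
      gcongr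
      exact norm_mulOp_le _ _ _ _)
    (by simpa only [LinearIsometryEquiv.norm_map] using h1.summable)
  have hw' : Integrable (A.indicator (fun _ => (1 : ℂ))) N :=
    .of_bound (measurable_indicator_one hA).aestronglyMeasurable 1
      (Eventually.of_forall fun x => norm_indicator_one_le A x)
  have hX : Measurable fun ξ : Conf n => mask θ true ((2 * Real.pi * ħ) • ξ) :=
    (measurable_mask θ true).comp (measurable_const_smul _)
  have hch : ∀ t ξ : Conf n, character t (mask θ true ((2 * Real.pi * ħ) • ξ)) =
      character ((2 * Real.pi) • (ħ • mask θ true t)) ξ := fun t ξ => by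
    rw [← character_mask, character, character, inner_smul_right, inner_smul_left, inner_smul_left]
    congr 3
    simp
    ring
  have h := integral_eq_of_character hX (measurable_mask θ true) hw hw'
    (fun t => by
      simp only [hch, ← character_mask]
      rw [← hwf _ (measurable_character _) (norm_character_le _)]
      have e0 : ∀ j, mulOp (character ((2 * Real.pi) • (ħ • mask θ true t)))
          (measurable_character _) (norm_character_le _) (F (ψ j)) =
            F (translation (ħ • mask θ true t) (ψ j)) := fun j => (fourier_translation _ _).symm
      simp only [e0, LinearIsometryEquiv.inner_map_map, inner_posProj_left]
      rw [step t]
      simp only [mul_comm]) (measurable_indicator_one hB) (norm_indicator_one_le B)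
  simp only [ind B true hBm] at h
  have hind : ∀ ξ : Conf n, B.indicator (fun _ => (1 : ℂ)) ((2 * Real.pi * ħ) • ξ) =
      ((fun ξ : Conf n => (2 * Real.pi * ħ) • ξ) ⁻¹' B).indicator (fun _ => 1) ξ := fun ξ => rfl
  simp only [hind] at h
  rw [← hwf _ (measurable_indicator_one (measurableSet_smul_preimage _ hB))
    (norm_indicator_one_le _)] at h
  rw [hψ]
  have e1 : ∀ j, inner ℂ (ψ j) ((posProj A hA ∘L momProj ħ B hB) (ψ j)) =
      inner ℂ (F (posProj A hA (ψ j))) (mulOp _ (measurable_indicator_one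
        (measurableSet_smul_preimage (2 * Real.pi * ħ) hB)) (norm_indicator_one_le _)
          (F (ψ j))) := by
    intro j
    rw [ContinuousLinearMap.comp_apply, ← inner_posProj_left, ← F.inner_map_map]
    congr 1
    exact F.apply_symm_apply _
  simp only [e1, h]
  rw [← integral_indicator_one (hA.inter hB), ← integral_complex_ofReal]
  refine integral_congr_ae (Eventually.of_forall fun x => ?_)
  by_cases hxA : x ∈ A <;> by_cases hxB : x ∈ B <;> simp [hxA, hxB]

/-! ### Power sums of binned Gaussian distributions -/

open ProbabilityTheory
open scoped NNReal

/-- Jensen's inequality for `x ↦ x ^ α` and a measure of arbitrary mass. -/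
theorem lintegral_rpow_le_mul {Ω : Type*} [MeasurableSpace Ω] (μ : Measure Ω) {α : ℝ} (hα : 1 < α)
    {h : Ω → ℝ≥0∞} (hh : AEMeasurable h μ) :
    (∫⁻ ω, h ω ∂μ) ^ α ≤ μ Set.univ ^ (α - 1) * ∫⁻ ω, h ω ^ α ∂μ := by
  have hα0 : 0 < α := by linarith
  have hpq := Real.HolderConjugate.conjExponent hα
  have H := ENNReal.lintegral_mul_le_Lp_mul_Lq μ hpq hh (aemeasurable_const (b := (1 : ℝ≥0∞)))
  simp only [Pi.mul_apply, mul_one, ENNReal.one_rpow, lintegral_one] at H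
  calc (∫⁻ ω, h ω ∂μ) ^ α
      ≤ ((∫⁻ ω, h ω ^ α ∂μ) ^ (1 / α) * μ Set.univ ^ (1 / α.conjExponent)) ^ α := by gcongr
    _ = μ Set.univ ^ (α - 1) * ∫⁻ ω, h ω ^ α ∂μ := by
      rw [ENNReal.mul_rpow_of_nonneg _ _ hα0.le, ← ENNReal.rpow_mul, ← ENNReal.rpow_mul,
        one_div_mul_cancel hα0.ne', ENNReal.rpow_one, mul_comm]
      congr 2
      rw [Real.conjExponent]
      have : α - 1 ≠ 0 := by linarith
      field_simp

/-- A power of a Gaussian density is a multiple of a Gaussian density. -/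
theorem gaussianPDFReal_rpow (m : ℝ) {s a : ℝ≥0} (hs : s ≠ 0) (ha : a ≠ 0) (x : ℝ) :
    gaussianPDFReal m s x ^ (a : ℝ) =
      (√(2 * Real.pi * s) ^ (a : ℝ))⁻¹ * (√(2 * Real.pi * s) / √a) *
        gaussianPDFReal m (s / a) x := by
  have hs' : (0 : ℝ) < s := by positivity
  have ha' : (0 : ℝ) < a := by positivity
  rw [gaussianPDFReal, gaussianPDFReal, Real.mul_rpow (by positivity) (by positivity),
    ← Real.exp_mul, Real.inv_rpow (by positivity)]
  have e1 : √(2 * Real.pi * s) / √a * (√(2 * Real.pi * ((s / a : ℝ≥0) : ℝ)))⁻¹ = 1 := by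
    rw [NNReal.coe_div, ← mul_div_assoc, Real.sqrt_div (by positivity), inv_div]
    field_simp
  rw [← mul_assoc, mul_assoc (√(2 * Real.pi * s) ^ (a : ℝ))⁻¹, e1, mul_one]
  congr 2
  push_cast
  field_simp

/-- The `α`-power sum of a Gaussian distribution over bins of length `δ` is at most one, and by
Jensen's inequality on each bin it is at most `δ^(α - 1) ∫ f^α` for the Gaussian density `f`. -/
theorem tsum_gaussianReal_bin_rpow_le {δ : ℝ} (hδ : 0 < δ) (I : Binning δ) {α : ℝ} (hα : 1 < α)
    (m : ℝ) {s : ℝ≥0} (hs : s ≠ 0) :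
    ∑' k, gaussianReal m s (I.bin k) ^ α ≤
      min 1 (ENNReal.ofReal ((√α)⁻¹ * (δ / √(2 * Real.pi * s)) ^ (α - 1))) := by
  have hmeas : ∀ k, MeasurableSet (I.bin k) := fun k => (I.ordConnected k).measurableSet
  refine le_min ?_ ?_
  · calc ∑' k, gaussianReal m s (I.bin k) ^ α ≤ ∑' k, gaussianReal m s (I.bin k) := by
          refine ENNReal.tsum_le_tsum fun k => ?_
          nth_rw 2 [← ENNReal.rpow_one (gaussianReal m s (I.bin k))]
          exact ENNReal.rpow_le_rpow_of_exponent_ge prob_le_one hα.le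
      _ = 1 := by rw [← measure_iUnion I.disjoint hmeas, I.cover, measure_univ]
  · lift α to ℝ≥0 using by linarith
    have hα0 : α ≠ 0 := by
      rintro rfl
      norm_num at hα
    have hs' : (0 : ℝ) < s := by positivity
    set c : ℝ := (√(2 * Real.pi * s) ^ (α : ℝ))⁻¹ * (√(2 * Real.pi * s) / √α) with hc
    have hc0 : 0 ≤ c := by positivity
    have e : ∀ x, gaussianPDF m s x ^ (α : ℝ) =
        ENNReal.ofReal c * gaussianPDF m (s / α) x := by
      intro x
      rw [gaussianPDF, gaussianPDF, ENNReal.ofReal_rpow_of_nonneg (gaussianPDFReal_nonneg _ _ _)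
        (by positivity), gaussianPDFReal_rpow m hs hα0, ENNReal.ofReal_mul hc0]
    calc ∑' k, gaussianReal m s (I.bin k) ^ (α : ℝ)
        ≤ ∑' k, ENNReal.ofReal δ ^ ((α : ℝ) - 1) *
            ∫⁻ x in I.bin k, ENNReal.ofReal c * gaussianPDF m (s / α) x := by
          refine ENNReal.tsum_le_tsum fun k => ?_
          rw [gaussianReal_apply _ hs]
          refine (lintegral_rpow_le_mul _ hα
            (measurable_gaussianPDF m s).aemeasurable).trans_eq ?_
          rw [Measure.restrict_apply_univ, I.length]
          simp only [e]
      _ = ENNReal.ofReal δ ^ ((α : ℝ) - 1) * ENNReal.ofReal c := by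
          rw [ENNReal.tsum_mul_left, ← lintegral_iUnion hmeas I.disjoint, I.cover,
            Measure.restrict_univ, lintegral_const_mul _ (measurable_gaussianPDF _ _),
            lintegral_gaussianPDF_eq_one m (div_ne_zero hs hα0), mul_one]
      _ = ENNReal.ofReal ((√α)⁻¹ * (δ / √(2 * Real.pi * s)) ^ ((α : ℝ) - 1)) := by
          rw [ENNReal.ofReal_rpow_of_pos hδ, ← ENNReal.ofReal_mul (by positivity)]
          congr 1
          have hr : 0 < √(2 * Real.pi * s) := by positivity
          rw [Real.div_rpow hδ.le hr.le, Real.rpow_sub hr, Real.rpow_one, hc]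
          have := (Real.rpow_pos_of_pos hr α).ne'
          field_simp

/-- The combination of the two bounds on binned Gaussians for a pair of variances satisfying the
uncertainty relation. The sum is estimated by `a + b ≤ 1 + a b` for `a, b ≤ 1`. -/
theorem min_one_add_min_one_le {ħ δx δp α : ℝ} (hħ : 0 < ħ) (hδx : 0 < δx) (hδp : 0 < δp)
    (hα : 1 < α) {s s' : ℝ≥0} (h : ħ ^ 2 ≤ 4 * s * s') :
    min 1 (ENNReal.ofReal ((√α)⁻¹ * (δx / √(2 * Real.pi * s)) ^ (α - 1))) +
      min 1 (ENNReal.ofReal ((√α)⁻¹ * (δp / √(2 * Real.pi * s')) ^ (α - 1))) ≤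
        ENNReal.ofReal (1 + 1 / α * (δx * δp / (Real.pi * ħ)) ^ (α - 1)) := by
  have hα0 : 0 < α := by linarith
  have hss : (0 : ℝ) < s * s' := by nlinarith [sq_pos_of_pos hħ]
  have hs : (0 : ℝ) < s := by
    rcases s.2.lt_or_eq with h | h
    · exact h
    · exfalso
      have : (s : ℝ) = 0 := h.symm
      simp [this] at hss
  have hs' : (0 : ℝ) < s' := by
    rcases s'.2.lt_or_eq with h | h
    · exact h
    · exfalso
      have : (s' : ℝ) = 0 := h.symm
      simp [this] at hss
  set a := (√α)⁻¹ * (δx / √(2 * Real.pi * s)) ^ (α - 1) with ha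
  set b := (√α)⁻¹ * (δp / √(2 * Real.pi * s')) ^ (α - 1) with hb
  have ha0 : 0 ≤ a := by positivity
  have hb0 : 0 ≤ b := by positivity
  have hab : a * b ≤ 1 / α * (δx * δp / (Real.pi * ħ)) ^ (α - 1) := by
    have e : a * b = 1 / α * (δx * δp / (√(2 * Real.pi * s) * √(2 * Real.pi * s'))) ^ (α - 1) := by
      rw [ha, hb, mul_mul_mul_comm, ← mul_inv, Real.mul_self_sqrt hα0.le,
        ← Real.mul_rpow (by positivity) (by positivity), div_mul_div_comm, one_div]
    rw [e]
    have : Real.pi * ħ ≤ √(2 * Real.pi * s) * √(2 * Real.pi * s') := by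
      rw [← Real.sqrt_mul (by positivity)]
      refine Real.le_sqrt_of_sq_le ?_
      nlinarith [mul_le_mul_of_nonneg_left h (sq_nonneg Real.pi)]
    have hα1 : 0 ≤ α - 1 := by linarith
    gcongr
  have e1 : ∀ x : ℝ, min 1 (ENNReal.ofReal x) = ENNReal.ofReal (min 1 x) := fun x => by
    rw [ENNReal.ofReal_min, ENNReal.ofReal_one]
  rw [e1, e1, ← ENNReal.ofReal_add (by positivity) (by positivity)]
  refine ENNReal.ofReal_le_ofReal ?_
  have h1 : min 1 a * min 1 b ≤ a * b := by
    gcongr <;> exact min_le_right _ _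
  nlinarith [min_le_left 1 a, min_le_left 1 b]

/-! ### Conditioning on all modes but one -/

section Tree

variable {E : Type*} [AddCommGroup E] [Module ℝ E]

/-- The combination `∑ t i • e i (θ i)` of the quadratures selected by `θ`. -/
def comb {m : ℕ} (e : Fin m → Bool → E) (θ : Fin m → Bool) (t : Fin m → ℝ) : E :=
  ∑ i, t i • e i (θ i)

theorem comb_add {m : ℕ} (e : Fin m → Bool → E) (θ : Fin m → Bool) (s t : Fin m → ℝ) :
    comb e θ (s + t) = comb e θ s + comb e θ t := by
  simp [comb, add_smul, Finset.sum_add_distrib]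

theorem comb_smul {m : ℕ} (e : Fin m → Bool → E) (θ : Fin m → Bool) (r : ℝ) (t : Fin m → ℝ) :
    comb e θ (r • t) = r • comb e θ t := by
  simp [comb, Finset.smul_sum, mul_smul]

theorem comb_cons {m : ℕ} (e : Fin (m + 1) → Bool → E) (c : Bool) (θ : Fin m → Bool) (r : ℝ)
    (t : Fin m → ℝ) :
    comb e (Fin.cons c θ) (Fin.cons r t) = r • e 0 c + comb (fun i => e i.succ) θ t := by
  simp [comb, Fin.sum_univ_succ]

/-- The symplectic form of the position quadrature `false` and the momentum quadrature `true` of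
one mode. -/
def symplecticSign : Bool → Bool → ℝ
  | false, true => 1
  | true, false => -1
  | _, _ => 0

@[simp] theorem symplecticSign_self (c : Bool) : symplecticSign c c = 0 := by
  cases c <;> rfl

/-- The quadratures `e` satisfy the uncertainty relations for the covariance form `B`. -/
def Uncertain {m : ℕ} (ħ : ℝ) (B : E →ₗ[ℝ] E →ₗ[ℝ] ℝ) (e : Fin m → Bool → E) : Prop :=
  ∀ θ θ' t t', (ħ * ∑ i, t i * t' i * symplecticSign (θ i) (θ' i)) ^ 2 ≤
    4 * B (comb e θ t) (comb e θ t) * B (comb e θ' t') (comb e θ' t')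

theorem Uncertain.succ {m : ℕ} {ħ : ℝ} {B : E →ₗ[ℝ] E →ₗ[ℝ] ℝ} {e : Fin (m + 1) → Bool → E}
    (h : Uncertain ħ B e) : Uncertain ħ B fun i => e i.succ := by
  intro θ θ' t t'
  have := h (Fin.cons false θ) (Fin.cons false θ') (Fin.cons 0 t) (Fin.cons 0 t')
  simpa [comb_cons, Fin.sum_univ_succ] using this

/-- No combination of commuting quadratures is deterministic. -/
theorem Uncertain.eq_zero {m : ℕ} {ħ : ℝ} (hħ : 0 < ħ) {B : E →ₗ[ℝ] E →ₗ[ℝ] ℝ}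
    {e : Fin m → Bool → E} (h : Uncertain ħ B e) (θ : Fin m → Bool) (t : Fin m → ℝ)
    (h0 : B (comb e θ t) (comb e θ t) = 0) : t = 0 := by
  ext i
  have := h θ (fun j => !θ j) t (Pi.single i 1)
  rw [h0, Finset.sum_eq_single i (fun j _ hj => by simp [hj]) (by simp)] at this
  have h2 : symplecticSign (θ i) (!θ i) ≠ 0 := by
    cases θ i <;> simp [symplecticSign]
  simp only [Pi.single_eq_same, mul_zero, zero_mul] at this
  have h3 := pow_eq_zero_iff two_ne_zero |>.1 (le_antisymm this (sq_nonneg _))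
  simpa [hħ.ne', h2] using h3

/-- The conditional expectation of a quadrature given commuting ones: the covariance-orthogonal
projection exists because the Gram matrix is nondegenerate. -/
theorem Uncertain.exists_projection {m : ℕ} {ħ : ℝ} (hħ : 0 < ħ) {B : E →ₗ[ℝ] E →ₗ[ℝ] ℝ}
    {e : Fin m → Bool → E} (h : Uncertain ħ B e) (θ : Fin m → Bool) (v : E) :
    ∃ τ : Fin m → ℝ, ∀ t, B (comb e θ t) (v - comb e θ τ) = 0 := by
  let L : (Fin m → ℝ) →ₗ[ℝ] (Fin m → ℝ) :=
    { toFun := fun τ i => B (e i (θ i)) (comb e θ τ)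
      map_add' := fun s t => by
        ext i
        simp [comb_add]
      map_smul' := fun r t => by
        ext i
        simp [comb_smul] }
  have hB : ∀ t u, B (comb e θ t) u = ∑ i, t i * B (e i (θ i)) u := fun t u => by
    simp [comb]
  have hinj : Function.Injective L := by
    rw [injective_iff_map_eq_zero]
    intro τ hτ
    refine h.eq_zero hħ θ τ ?_
    rw [hB]
    refine Finset.sum_eq_zero fun i _ => ?_
    have : L τ i = 0 := by rw [hτ]; rfl
    change B (e i (θ i)) (comb e θ τ) = 0 at this
    rw [this, mul_zero]
  obtain ⟨τ, hτ⟩ := LinearMap.injective_iff_surjective.1 hinj fun i => B (e i (θ i)) v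
  refine ⟨τ, fun t => ?_⟩
  rw [hB]
  refine Finset.sum_eq_zero fun i _ => ?_
  have : B (e i (θ i)) (comb e θ τ) = B (e i (θ i)) v := congrFun hτ i
  rw [map_sub, this, sub_self, mul_zero]

/-- The characteristic function of a Gaussian with mean `ℓ` and covariance `B` at `v`. -/
noncomputable def gaussChar (B : E →ₗ[ℝ] E →ₗ[ℝ] ℝ) (ℓ : E →ₗ[ℝ] ℝ) (v : E) : ℂ :=
  Complex.exp (Complex.I * ((ℓ v : ℝ) : ℂ) - ((B v v : ℝ) : ℂ) / 2)

/-- `N` is the joint distribution of the quadratures selected by `θ`. -/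
def IsGaussLaw {m : ℕ} (B : E →ₗ[ℝ] E →ₗ[ℝ] ℝ) (ℓ : E →ₗ[ℝ] ℝ) (e : Fin m → Bool → E)
    (θ : Fin m → Bool) (N : Measure (Conf m)) : Prop :=
  IsProbabilityMeasure N ∧ ∀ t : Conf m, ∫ x, character t x ∂N = gaussChar B ℓ (comb e θ t)

theorem measure_ext_of_character {m : ℕ} {P Q : Measure (Conf m)} [IsFiniteMeasure P]
    [IsFiniteMeasure Q] (h : ∀ t, ∫ x, character t x ∂P = ∫ x, character t x ∂Q) : P = Q := by
  refine Measure.ext_of_charFun (funext fun t => ?_)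
  have e : ∀ x : Conf m, Complex.exp (inner ℝ x t * Complex.I) = character t x := fun x => by
    rw [character, real_inner_comm, mul_comm]
  simp only [charFun_apply, e, h]

/-- Dropping the first coordinate. -/
def tailConf {m : ℕ} (x : Conf (m + 1)) : Conf m := WithLp.toLp 2 fun i => x i.succ

theorem measurable_tailConf {m : ℕ} : Measurable (tailConf (m := m)) := by
  have : Continuous (tailConf (m := m)) := by
    unfold tailConf
    fun_prop
  exact this.measurable

theorem character_tailConf {m : ℕ} (t : Conf m) (x : Conf (m + 1)) :
    character t (tailConf x) =
      character (WithLp.toLp 2 (Fin.cons 0 t : Fin (m + 1) → ℝ) : Conf (m + 1)) x := by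
  simp [character, PiLp.inner_apply, Fin.sum_univ_succ, tailConf]

theorem IsGaussLaw.map_tailConf {m : ℕ} {B : E →ₗ[ℝ] E →ₗ[ℝ] ℝ} {ℓ : E →ₗ[ℝ] ℝ}
    {e : Fin (m + 1) → Bool → E} {c : Bool} {θ : Fin m → Bool} {N : Measure (Conf (m + 1))}
    (h : IsGaussLaw B ℓ e (Fin.cons c θ) N) :
    IsGaussLaw B ℓ (fun i => e i.succ) θ (N.map tailConf) := by
  have := h.1
  refine ⟨Measure.isProbabilityMeasure_map measurable_tailConf.aemeasurable, fun t => ?_⟩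
  rw [integral_map measurable_tailConf.aemeasurable
    (measurable_character t).aestronglyMeasurable]
  simp only [character_tailConf]
  rw [h.2]
  congr 1
  have := comb_cons e c θ 0 t
  rw [zero_smul, zero_add] at this
  exact this

/-- Appending a first coordinate that is `g` plus a linear function of the others. -/
noncomputable def consConf {m : ℕ} (τ : Fin m → ℝ) (p : Conf m × ℝ) : Conf (m + 1) :=
  WithLp.toLp 2 (Fin.cons (∑ i, τ i * p.1 i + p.2) p.1)

theorem measurable_consConf {m : ℕ} (τ : Fin m → ℝ) : Measurable (consConf τ) := by
  have : Continuous (consConf τ) := by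
    refine (PiLp.continuous_toLp 2 _).comp (continuous_pi fun i => ?_)
    refine Fin.cases ?_ (fun j => ?_) i
    · simp only [Fin.cons_zero]
      fun_prop
    · simp only [Fin.cons_succ]
      fun_prop
  exact this.measurable

/-- A Gaussian vector is its tail together with an independent Gaussian shifted by the regression
of the first coordinate on the tail. -/
theorem IsGaussLaw.eq_map_consConf {m : ℕ} {B : E →ₗ[ℝ] E →ₗ[ℝ] ℝ}
    (hsymm : ∀ u v, B u v = B v u) {ℓ : E →ₗ[ℝ] ℝ} {e : Fin (m + 1) → Bool → E} {c : Bool}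
    {θ : Fin m → Bool} {N : Measure (Conf (m + 1))} (h : IsGaussLaw B ℓ e (Fin.cons c θ) N)
    {N' : Measure (Conf m)} (h' : IsGaussLaw B ℓ (fun i => e i.succ) θ N') (τ : Fin m → ℝ)
    {f : E} (hf : f = e 0 c - comb (fun i => e i.succ) θ τ)
    (hτ : ∀ t, B (comb (fun i => e i.succ) θ t) f = 0) {s : ℝ≥0} (hs : B f f = s) :
    N = (N'.prod (gaussianReal (ℓ f) s)).map (consConf τ) := by
  have := h.1
  have := h'.1
  have : IsProbabilityMeasure ((N'.prod (gaussianReal (ℓ f) s)).map (consConf τ)) :=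
    Measure.isProbabilityMeasure_map (measurable_consConf τ).aemeasurable
  refine measure_ext_of_character fun t => ?_
  rw [h.2, integral_map (measurable_consConf τ).aemeasurable
    (measurable_character t).aestronglyMeasurable]
  set t' : Conf m := tailConf t + t 0 • WithLp.toLp 2 τ with ht'
  have e1 : ∀ p : Conf m × ℝ, character t (consConf τ p) =
      character t' p.1 * Complex.exp (t 0 * p.2 * Complex.I) := by
    intro p
    rw [character, character, ← Complex.exp_add]
    congr 1
    have : (inner ℝ t (consConf τ p) : ℝ) = inner ℝ t' p.1 + t 0 * p.2 := by
      simp only [PiLp.inner_apply, Fin.sum_univ_succ, consConf, ht', tailConf, Fin.cons_zero,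
        Fin.cons_succ, PiLp.add_apply, PiLp.smul_apply, RCLike.inner_apply, conj_trivial,
        smul_eq_mul, mul_add, Finset.sum_add_distrib, add_mul, Finset.sum_mul]
      have e5 : ∑ i, p.1 i * (t 0 * τ i) = ∑ i, τ i * p.1 i * t 0 :=
        Finset.sum_congr rfl fun i _ => by ring
      rw [e5]
      ring
    rw [this]
    push_cast
    ring
  simp only [e1]
  rw [integral_prod_mul (fun x => character t' x)
    (fun g : ℝ => Complex.exp (t 0 * g * Complex.I)), h'.2, ← charFun_apply_real,
    charFun_gaussianReal, gaussChar, gaussChar, ← Complex.exp_add]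
  have e2 : comb e (Fin.cons c θ) t = comb (fun i => e i.succ) θ t' + t 0 • f := by
    have e3 : (t : Fin (m + 1) → ℝ) = Fin.cons (t 0) (tailConf t) := by
      ext i
      refine Fin.cases ?_ (fun j => ?_) i <;> simp [tailConf]
    have e4 : (t' : Fin m → ℝ) = tailConf t + t 0 • τ := rfl
    rw [e3, comb_cons, e4, comb_add, comb_smul, hf, smul_sub]
    simp only [Fin.cons_zero]
    abel
  rw [e2]
  congr 1
  simp only [map_add, map_smul, LinearMap.add_apply, LinearMap.smul_apply, hτ,
    hsymm f (comb _ _ _), hs, smul_eq_mul]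
  push_cast
  ring

/-- The set of vectors whose `i`-th coordinate lies in the bin `z i` of the quadrature `θ i`. -/
def box {m : ℕ} (β : Bool → ℕ → Set ℝ) (θ : Fin m → Bool) (z : Fin m → ℕ) : Set (Conf m) :=
  {x | ∀ i, x i ∈ β (θ i) (z i)}

theorem measurableSet_box {m : ℕ} {β : Bool → ℕ → Set ℝ} (hβ : ∀ c k, MeasurableSet (β c k))
    (θ : Fin m → Bool) (z : Fin m → ℕ) : MeasurableSet (box β θ z) := by
  have h : box β θ z = ⋂ i, (fun x : Conf m => x i) ⁻¹' β (θ i) (z i) := by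
    ext x; simp [box]
  rw [h]
  refine MeasurableSet.iInter fun i => ?_
  have hm : Measurable fun x : Conf m => x i := by fun_prop
  exact hm (hβ _ _)

/-- Conditionally on the other modes, the first outcome is a binned Gaussian, so its power sum is
at most the bound `T` for all binned Gaussians of the conditional variance. -/
theorem tsum_prod_box_rpow_le {m : ℕ} {β : Bool → ℕ → Set ℝ} (hβ : ∀ c k, MeasurableSet (β c k))
    {α : ℝ} (hα : 1 < α) {c : Bool} {s : ℝ≥0} {T : ℝ≥0∞}
    (hT : ∀ μ, ∑' k, gaussianReal μ s (β c k) ^ α ≤ T) (N : Measure (Conf m))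
    [IsProbabilityMeasure N] (μ : ℝ) (τ : Fin m → ℝ) (θ : Fin m → Bool) (z : Fin m → ℕ) :
    ∑' k, ((N.prod (gaussianReal μ s)).map (consConf τ)
      (box β (Fin.cons c θ) (Fin.cons k z))) ^ α ≤ T * N (box β θ z) ^ α := by
  have hbox := measurableSet_box hβ θ z
  have e1 : ∀ k, (N.prod (gaussianReal μ s)).map (consConf τ)
      (box β (Fin.cons c θ) (Fin.cons k z)) =
        ∫⁻ x in box β θ z, gaussianReal (μ + ∑ i, τ i * x i) s (β c k) ∂N := by
    intro k
    have hm := measurableSet_box hβ (Fin.cons c θ : Fin (m + 1) → Bool) (Fin.cons k z)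
    rw [Measure.map_apply (measurable_consConf τ) hm,
      Measure.prod_apply (measurable_consConf τ hm), ← lintegral_indicator hbox]
    refine lintegral_congr fun x => ?_
    by_cases hx : x ∈ box β θ z
    · rw [Set.indicator_of_mem hx, ← gaussianReal_map_const_add (∑ i, τ i * x i),
        Measure.map_apply (measurable_const_add _) (hβ c k)]
      congr 1
      ext g
      simp only [Set.mem_preimage, box, Set.mem_ofPred_eq, Fin.forall_fin_succ, Fin.cons_zero,
        Fin.cons_succ, consConf]
      exact and_iff_left hx
    · rw [Set.indicator_of_notMem hx]
      convert measure_empty (μ := gaussianReal μ s)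
      ext g
      simp only [Set.mem_preimage, box, Set.mem_ofPred_eq, Fin.forall_fin_succ, Fin.cons_zero,
        Fin.cons_succ, consConf, Set.mem_empty_iff_false, iff_false, not_and]
      exact fun _ => hx
  have hmeas : ∀ k, Measurable fun x : Conf m =>
      gaussianReal (μ + ∑ i, τ i * x i) s (β c k) := by
    intro k
    have h1 : ∀ x : Conf m, gaussianReal (μ + ∑ i, τ i * x i) s (β c k) =
        gaussianReal μ s (Prod.mk x ⁻¹'
          ((fun p : Conf m × ℝ => ∑ i, τ i * p.1 i + p.2) ⁻¹' β c k)) := fun x => by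
      rw [← gaussianReal_map_const_add (∑ i, τ i * x i),
        Measure.map_apply (measurable_const_add _) (hβ c k)]
      rfl
    simp only [h1]
    refine measurable_measure_prodMk_left ?_
    have : Measurable fun p : Conf m × ℝ => ∑ i, τ i * p.1 i + p.2 := by fun_prop
    exact this (hβ c k)
  simp only [e1]
  calc ∑' k, (∫⁻ x in box β θ z, gaussianReal (μ + ∑ i, τ i * x i) s (β c k) ∂N) ^ α
      ≤ ∑' k, N (box β θ z) ^ (α - 1) *
          ∫⁻ x in box β θ z, gaussianReal (μ + ∑ i, τ i * x i) s (β c k) ^ α ∂N := by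
        refine ENNReal.tsum_le_tsum fun k => ?_
        refine (lintegral_rpow_le_mul _ hα (hmeas k).aemeasurable).trans_eq ?_
        rw [Measure.restrict_apply_univ]
    _ = N (box β θ z) ^ (α - 1) *
          ∫⁻ x in box β θ z, ∑' k, gaussianReal (μ + ∑ i, τ i * x i) s (β c k) ^ α ∂N := by
        rw [ENNReal.tsum_mul_left, lintegral_tsum fun k => ((hmeas k).pow_const α).aemeasurable]
    _ ≤ N (box β θ z) ^ (α - 1) * ∫⁻ x in box β θ z, T ∂N := by
        gcongr
        exact hT _
    _ = T * N (box β θ z) ^ α := by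
        rw [lintegral_const, Measure.restrict_apply_univ]
        rcases eq_or_ne (N (box β θ z)) 0 with h | h
        · rw [h, mul_zero, mul_zero, ENNReal.zero_rpow_of_pos (by linarith), mul_zero]
        · have e2 : N (box β θ z) ^ α = N (box β θ z) ^ (α - 1) * N (box β θ z) := by
            conv_lhs => rw [← sub_add_cancel α 1, ENNReal.rpow_add _ _ h (measure_ne_top _ _),
              ENNReal.rpow_one]
          rw [e2, mul_left_comm]

/-- The power sums of the binned outcomes, averaged over the choice of quadratures, factorise over
the modes: `T c s` bounds the power sum of a binned Gaussian of variance `s`, and `D` bounds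
`T false s + T true s'` for variances obeying the uncertainty relation. Removing one mode replaces
its variances by the conditional ones, given quadratures that commute with that mode and hence do
not weaken its uncertainty relation. -/
theorem sum_tsum_box_rpow_le {ħ α : ℝ} (hħ : 0 < ħ) (hα : 1 < α) {B : E →ₗ[ℝ] E →ₗ[ℝ] ℝ}
    (hsymm : ∀ u v, B u v = B v u) (hpos : ∀ u, 0 ≤ B u u) (ℓ : E →ₗ[ℝ] ℝ)
    {β : Bool → ℕ → Set ℝ} (hβ : ∀ c k, MeasurableSet (β c k)) {T : Bool → ℝ≥0 → ℝ≥0∞}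
    {D : ℝ≥0∞} (hT : ∀ c s, s ≠ 0 → ∀ μ, ∑' k, gaussianReal μ s (β c k) ^ α ≤ T c s)
    (hTD : ∀ s s' : ℝ≥0, ħ ^ 2 ≤ 4 * s * s' → T false s + T true s' ≤ D) {m : ℕ}
    {e : Fin m → Bool → E} (he : Uncertain ħ B e) {N : (Fin m → Bool) → Measure (Conf m)}
    (hN : ∀ θ, IsGaussLaw B ℓ e θ (N θ)) :
    ∑ θ, ∑' z, N θ (box β θ z) ^ α ≤ D ^ m := by
  induction m with
  | zero =>
    have := fun θ => (hN θ).1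
    rw [pow_zero, Fintype.sum_unique,
      tsum_eq_single default fun z hz => (hz (Subsingleton.elim _ _)).elim]
    exact ENNReal.rpow_le_one prob_le_one (by linarith)
  | succ m ih =>
    have he' := he.succ
    set e' : Fin m → Bool → E := fun i => e i.succ
    set N' : (Fin m → Bool) → Measure (Conf m) := fun θ => (N (Fin.cons false θ)).map tailConf
    have hN' : ∀ θ, IsGaussLaw B ℓ e' θ (N' θ) := fun θ => (hN _).map_tailConf
    have key : ∀ θ, ∑ c, ∑' z : Fin (m + 1) → ℕ, N (Fin.cons c θ) (box β (Fin.cons c θ) z) ^ α ≤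
        D * ∑' z, N' θ (box β θ z) ^ α := by
      intro θ
      choose τ hτ using fun c => he'.exists_projection hħ θ (e 0 c)
      set f : Bool → E := fun c => e 0 c - comb e' θ (τ c) with hf
      have hf' : ∀ c, f c = comb e (Fin.cons c θ) (Fin.cons 1 (-τ c)) := fun c => by
        have := comb_smul e' θ (-1) (τ c)
        rw [neg_one_smul, neg_one_smul] at this
        rw [comb_cons, one_smul, this, ← sub_eq_add_neg]
      set s : Bool → ℝ≥0 := fun c => ⟨B (f c) (f c), hpos _⟩ with hs
      have hss : ħ ^ 2 ≤ 4 * (s false : ℝ) * s true := by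
        have := he (Fin.cons false θ) (Fin.cons true θ) (Fin.cons 1 (-τ false))
          (Fin.cons 1 (-τ true))
        rw [← hf', ← hf'] at this
        change ħ ^ 2 ≤ 4 * B (f false) (f false) * B (f true) (f true)
        simpa [Fin.sum_univ_succ, symplecticSign] using this
      have hs0 : ∀ c, s c ≠ 0 := by
        have : 0 < ħ ^ 2 := by positivity
        intro c hc
        cases c <;> · rw [hc] at hss; simp at hss; linarith
      have hc : ∀ c, ∑' z : Fin (m + 1) → ℕ, N (Fin.cons c θ) (box β (Fin.cons c θ) z) ^ α ≤
          T c (s c) * ∑' z, N' θ (box β θ z) ^ α := by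
        intro c
        have := (hN' θ).1
        rw [(hN (Fin.cons c θ)).eq_map_consConf hsymm (hN' θ) (τ c) rfl (hτ c) (s := s c) rfl,
          ← (Fin.consEquiv fun _ => ℕ).tsum_eq, ENNReal.tsum_prod', ENNReal.tsum_comm,
          ← ENNReal.tsum_mul_left]
        exact ENNReal.tsum_le_tsum fun z =>
          tsum_prod_box_rpow_le hβ hα (hT c (s c) (hs0 c)) (N' θ) _ (τ c) θ z
      rw [Fintype.sum_bool, add_comm]
      refine (add_le_add (hc false) (hc true)).trans ?_
      rw [← add_mul]
      gcongr
      exact hTD _ _ hss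
    calc ∑ θ, ∑' z, N θ (box β θ z) ^ α
        = ∑ θ : Fin m → Bool, ∑ c, ∑' z : Fin (m + 1) → ℕ,
            N (Fin.cons c θ) (box β (Fin.cons c θ) z) ^ α := by
          rw [← (Fin.consEquiv fun _ => Bool).sum_comp, Fintype.sum_prod_type, Finset.sum_comm]
          rfl
      _ ≤ ∑ θ, D * ∑' z, N' θ (box β θ z) ^ α := Finset.sum_le_sum fun θ _ => key θ
      _ ≤ D * D ^ m := by
          rw [← Finset.mul_sum]
          gcongr
          exact ih he' hN'
      _ = D ^ (m + 1) := (pow_succ' D m).symm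

end Tree

/-! ### Outcome distributions of Gaussian states -/

theorem norm_charFn_le {n : ℕ} (ħ : ℝ) (ρ : State n) (a b : Conf n) : ‖charFn ħ ρ a b‖ ≤ 1 := by
  obtain ⟨ψ, h1, hψ⟩ := ρ.exists_vectors
  rw [charFn, hψ, ← h1.tsum_eq]
  refine tsum_of_norm_bounded h1.summable.hasSum fun j => (norm_inner_le_norm _ _).trans ?_
  rw [sq]
  gcongr
  exact norm_weyl_le ħ a b _

/-- The position quadrature `false` or the momentum quadrature `true` of mode `i`, as a vector of
the phase space. -/
def quadrature {n : ℕ} (i : Fin n) (c : Bool) : Fin n ⊕ Fin n → ℝ :=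
  Pi.single (if c then Sum.inr i else Sum.inl i) 1

theorem comb_quadrature {n : ℕ} (θ : Fin n → Bool) (t : Conf n) :
    comb quadrature θ t = Sum.elim (mask θ false t) (mask θ true t) := by
  ext k
  rw [comb, Finset.sum_apply]
  rcases k with k | k
  · rw [Finset.sum_eq_single k]
    · cases h : θ k <;> simp [quadrature, h]
    · intro j _ hj
      cases θ j <;> simp [quadrature, hj.symm]
    · simp
  · rw [Finset.sum_eq_single k]
    · cases h : θ k <;> simp [quadrature, h]
    · intro j _ hj
      cases θ j <;> simp [quadrature, hj.symm]
    · simp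

theorem toLinearMap₂'_sumElim {n : ℕ} (V : Matrix (Fin n ⊕ Fin n) (Fin n ⊕ Fin n) ℝ)
    (a b : Conf n) : Matrix.toLinearMap₂' ℝ V (Sum.elim a b) (Sum.elim a b) = covForm V a b :=
  Matrix.toLinearMap₂'_apply' V _ _

/-- The mean of a quadrature, as a linear form. -/
def meanForm {ι : Type*} [Fintype ι] (d : ι → ℝ) : (ι → ℝ) →ₗ[ℝ] ℝ where
  toFun v := d ⬝ᵥ v
  map_add' v w := dotProduct_add d v w
  map_smul' r v := dotProduct_smul r d v

/-- The intervals of the two coarse-grained measurements. -/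
def bins {δx δp : ℝ} (I : Binning δx) (J : Binning δp) (c : Bool) (k : ℕ) : Set ℝ :=
  if c then J.bin k else I.bin k

theorem measurableSet_bins {δx δp : ℝ} (I : Binning δx) (J : Binning δp) (c : Bool) (k : ℕ) :
    MeasurableSet (bins I J c k) := by
  cases c
  · exact (I.ordConnected k).measurableSet
  · exact (J.ordConnected k).measurableSet

theorem cell_inter_cell {n : ℕ} {δx δp : ℝ} (I : Binning δx) (J : Binning δp)
    (θ : Fin n → Bool) (z : Fin n → ℕ) :
    cell I θ false z ∩ cell J θ true z = box (bins I J) θ z := by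
  ext x
  simp only [cell, box, bins, Set.mem_inter_iff, Set.mem_ofPred_eq, ← forall_and]
  refine forall_congr' fun i => ?_
  cases h : θ i <;> simp

theorem mask_mem_cell {n : ℕ} {δ : ℝ} (I : Binning δ) (θ : Fin n → Bool) (c : Bool)
    (z : Fin n → ℕ) (x : Conf n) : mask θ c x ∈ cell I θ c z ↔ x ∈ cell I θ c z := by
  simp only [cell, Set.mem_ofPred_eq, mask_apply]
  refine forall_congr' fun i => ?_
  by_cases h : θ i = c <;> simp [h]

theorem exists_isGaussLaw {E : Type*} [AddCommGroup E] [Module ℝ E] {m : ℕ}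
    {B : E →ₗ[ℝ] E →ₗ[ℝ] ℝ} (hsymm : ∀ u v, B u v = B v u) (hpos : ∀ u, 0 ≤ B u u)
    (ℓ : E →ₗ[ℝ] ℝ) (e : Fin m → Bool → E) (θ : Fin m → Bool) :
    ∃ N : Measure (Conf m), IsGaussLaw B ℓ e θ N := by
  set S : Matrix (Fin m) (Fin m) ℝ := Matrix.of fun i j => B (e i (θ i)) (e j (θ j)) with hS
  have hq : ∀ t : Fin m → ℝ, t ⬝ᵥ S.mulVec t = B (comb e θ t) (comb e θ t) := by
    intro t
    simp only [dotProduct, Matrix.mulVec, hS, Matrix.of_apply, comb, map_sum, map_smul,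
      LinearMap.sum_apply, LinearMap.smul_apply, smul_eq_mul, Finset.mul_sum]
    rw [Finset.sum_comm]
    exact Finset.sum_congr rfl fun i _ => Finset.sum_congr rfl fun j _ => by ring
  have hSp : S.PosSemidef := by
    refine Matrix.PosSemidef.of_dotProduct_mulVec_nonneg ?_ fun t => ?_
    · ext i j
      simp [hS, hsymm (e i (θ i))]
    · rw [star_trivial, hq]
      exact hpos _
  refine ⟨multivariateGaussian (WithLp.toLp 2 fun i => ℓ (e i (θ i))) S, inferInstance,
    fun t => ?_⟩
  have h := charFun_multivariateGaussian (μ := WithLp.toLp 2 fun i => ℓ (e i (θ i))) hSp t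
  rw [charFun_apply] at h
  have e1 : ∀ x : Conf m, Complex.exp (inner ℝ x t * Complex.I) = character t x := fun x => by
    rw [character, real_inner_comm, mul_comm]
  simp only [e1] at h
  rw [h, gaussChar, hq]
  have e2 : (inner ℝ t (WithLp.toLp 2 fun i => ℓ (e i (θ i)) : Conf m) : ℝ) =
      ℓ (comb e θ t) := by
    simp [PiLp.inner_apply, comb, mul_comm]
  rw [e2, mul_comm Complex.I]

/-- The outcomes of the coarse-grained measurements on a Gaussian state are binned Gaussian
variables, and their power sums obey the `n`-mode uncertainty bound. -/
theorem IsGaussian.exists_law {n : ℕ} {ħ δx δp : ℝ} (hħ : 0 < ħ) (hδx : 0 < δx) (hδp : 0 < δp)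
    (I : Binning δx) (J : Binning δp) {ρ : State n} (hρ : IsGaussian ħ ρ) :
    ∃ N : (Fin n → Bool) → Measure (Conf n), (∀ θ, IsProbabilityMeasure (N θ)) ∧
      (∀ θ z, trace (ρ.op ∘L effect ħ I J θ z) = ((N θ).real (box (bins I J) θ z) : ℂ)) ∧
      ∀ α : ℝ, 1 < α → ∑ θ, ∑' z, N θ (box (bins I J) θ z) ^ α ≤
        ENNReal.ofReal (1 + 1 / α * (δx * δp / (Real.pi * ħ)) ^ (α - 1)) ^ n := by
  obtain ⟨d, V, hV, hχ⟩ := hρ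
  set B : (Fin n ⊕ Fin n → ℝ) →ₗ[ℝ] (Fin n ⊕ Fin n → ℝ) →ₗ[ℝ] ℝ := Matrix.toLinearMap₂' ℝ V
  have hsymm : ∀ u v, B u v = B v u := fun u v => by
    simp only [B, Matrix.toLinearMap₂'_apply']
    rw [Matrix.dotProduct_mulVec, ← Matrix.mulVec_transpose, hV, dotProduct_comm]
  have hpos : ∀ u, 0 ≤ B u u := by
    intro u
    obtain ⟨a, b, rfl⟩ : ∃ a b : Conf n, u = Sum.elim a b :=
      ⟨WithLp.toLp 2 (u ∘ Sum.inl), WithLp.toLp 2 (u ∘ Sum.inr), (Sum.elim_comp_inl_inr u).symm⟩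
    have h := norm_charFn_le ħ ρ a b
    rw [hχ, Complex.norm_exp, Real.exp_le_one_iff] at h
    rw [toLinearMap₂'_sumElim]
    simp at h
    unfold covForm
    linarith
  have hunc : Uncertain ħ B (quadrature (n := n)) := by
    intro θ θ' t t'
    have h := sq_le_covForm_mul_covForm hχ (mask θ false (WithLp.toLp 2 t))
      (mask θ true (WithLp.toLp 2 t)) (mask θ' false (WithLp.toLp 2 t'))
      (mask θ' true (WithLp.toLp 2 t'))
    rw [← toLinearMap₂'_sumElim, ← toLinearMap₂'_sumElim, ← comb_quadrature,
      ← comb_quadrature] at h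
    refine le_trans (le_of_eq ?_) h
    congr 2
    simp only [PiLp.inner_apply, mask_apply, ← Finset.sum_sub_distrib]
    refine Finset.sum_congr rfl fun i _ => ?_
    cases h1 : θ i <;> cases h2 : θ' i <;> simp [symplecticSign] <;> ring
  choose N hN using exists_isGaussLaw hsymm hpos (meanForm d) (quadrature (n := n))
  refine ⟨N, fun θ => (hN θ).1, fun θ z => ?_, fun α hα => ?_⟩
  · have := (hN θ).1
    rw [effect, trace_posProj_momProj ρ θ (N θ) (fun t => ?_) (measurableSet_cell I θ false z)
      (measurableSet_cell J θ true z) (mask_mem_cell I θ false z) (mask_mem_cell J θ true z),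
      cell_inter_cell]
    rw [(hN θ).2, hχ, gaussChar, comb_quadrature, toLinearMap₂'_sumElim]
    rfl
  · refine sum_tsum_box_rpow_le hħ hα hsymm hpos (meanForm d) (measurableSet_bins I J)
      (T := fun c s => min 1 (ENNReal.ofReal ((√α)⁻¹ *
        ((if c then δp else δx) / √(2 * Real.pi * s)) ^ (α - 1)))) ?_ ?_ hunc hN
    · intro c s hs μ
      cases c
      · exact tsum_gaussianReal_bin_rpow_le hδx I hα μ hs
      · exact tsum_gaussianReal_bin_rpow_le hδp J hα μ hs
    · intro s s' h
      exact min_one_add_min_one_le hħ hδx hδp hα h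

/-! ### Mixtures of Gaussian states -/

theorem State.summable_trace {n : ℕ} (ρ : State n) (A : Modes n →L[ℂ] Modes n) :
    Summable fun i => inner ℂ (basis n i) (ρ.op (A (basis n i))) :=
  (summable_of_sum_le (fun _ => norm_nonneg _)
    (sum_norm_inner_le_of_isPositive (basis n) ρ.pos ρ.trace_one A)).of_norm

/-- The trace against a weak mixture of states is the mixture of the traces. -/
theorem trace_eq_integral_of_mixture {n : ℕ} {Y : Type*} [MeasurableSpace Y] {ν : Measure Y}
    [IsProbabilityMeasure ν] {ρ : State n} {σ : Y → State n}
    (h : ∀ φ ψ : Modes n, Integrable (fun y => inner ℂ φ ((σ y).op ψ)) ν ∧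
      inner ℂ φ (ρ.op ψ) = ∫ y, inner ℂ φ ((σ y).op ψ) ∂ν) (A : Modes n →L[ℂ] Modes n) :
    AEStronglyMeasurable (fun y => trace ((σ y).op ∘L A)) ν ∧
      trace (ρ.op ∘L A) = ∫ y, trace ((σ y).op ∘L A) ∂ν := by
  set F : basisIndex n → Y → ℂ := fun i y => inner ℂ (basis n i) ((σ y).op (A (basis n i)))
  have hF : ∀ i, Integrable (F i) ν := fun i => (h _ _).1
  constructor
  · refine aestronglyMeasurable_of_tendsto_ae atTop
      (f := fun (s : Finset (basisIndex n)) y => ∑ i ∈ s, F i y) (fun s => ?_)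
      (Eventually.of_forall fun y => ((σ y).summable_trace A).hasSum)
    exact Finset.aestronglyMeasurable_fun_sum s fun i _ => (hF i).1
  · have hs : Summable fun i => ∫ y, ‖F i y‖ ∂ν := by
      refine summable_of_sum_le (c := 1 / 2 * (1 + ‖A‖ ^ 2))
        (fun i => integral_nonneg fun y => norm_nonneg _) fun s => ?_
      rw [← integral_finsetSum s fun i _ => (hF i).norm]
      refine (integral_mono (integrable_finsetSum s fun i _ => (hF i).norm)
        (integrable_const (1 / 2 * (1 + ‖A‖ ^ 2))) fun y => ?_).trans_eq (by simp)
      exact sum_norm_inner_le_of_isPositive (basis n) (σ y).pos (σ y).trace_one A s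
    refine Eq.trans ?_ (hasSum_integral_of_summable_integral_norm hF hs).tsum_eq
    exact tsum_congr fun i => (h _ _).2

theorem tsum_measure_box {m : ℕ} {δx δp : ℝ} (I : Binning δx) (J : Binning δp)
    (θ : Fin m → Bool) (N : Measure (Conf m)) [IsProbabilityMeasure N] :
    ∑' z, N (box (bins I J) θ z) = 1 := by
  have hdis : ∀ c, Pairwise fun k l => Disjoint (bins I J c k) (bins I J c l) := by
    intro c
    cases c
    · exact I.disjoint
    · exact J.disjoint
  have hcov : ∀ c, ⋃ k, bins I J c k = Set.univ := by
    intro c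
    cases c
    · exact I.cover
    · exact J.cover
  rw [← measure_iUnion _ (measurableSet_box (measurableSet_bins I J) θ)]
  · have : ⋃ z, box (bins I J) θ z = Set.univ := by
      refine Set.eq_univ_of_forall fun x => ?_
      have hx : ∀ i, ∃ k, x i ∈ bins I J (θ i) k := fun i => by
        have : x i ∈ ⋃ k, bins I J (θ i) k := by rw [hcov]; trivial
        simpa using this
      choose z hz using hx
      exact Set.mem_iUnion.2 ⟨z, hz⟩
    rw [this, measure_univ]
  · intro z z' hzz
    obtain ⟨i, hi⟩ := Function.ne_iff.1 hzz
    exact Set.disjoint_left.2 fun x hx hx' =>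
      Set.disjoint_left.1 (hdis (θ i) hi) (hx i) (hx' i)

/-- The outcomes of the measurements on a Gaussian mixture form probability distributions whose
power sums obey the `n`-mode uncertainty bound. -/
theorem IsGaussianMixture.outcomeProb_bounds {n : ℕ} {ħ δx δp : ℝ} (hħ : 0 < ħ) (hδx : 0 < δx)
    (hδp : 0 < δp) (I : Binning δx) (J : Binning δp) {ρ : State n}
    (hρ : IsGaussianMixture.{u} ħ ρ) :
    (∀ θ z, 0 ≤ outcomeProb ħ I J ρ θ z) ∧ (∀ θ, HasSum (outcomeProb ħ I J ρ θ) 1) ∧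
      ∀ α : ℝ, 1 < α → ∑ θ, ∑' z, ENNReal.ofReal (outcomeProb ħ I J ρ θ z) ^ α ≤
        ENNReal.ofReal (1 + 1 / α * (δx * δp / (Real.pi * ħ)) ^ (α - 1)) ^ n := by
  obtain ⟨Y, mY, ν, σ, hν, hσ, h⟩ := hρ
  choose N hN hNt hNα using fun y => (hσ y).exists_law hħ hδx hδp I J
  have htr := fun θ z => trace_eq_integral_of_mixture h (effect ħ I J θ z)
  simp only [hNt] at htr
  have hmeas : ∀ θ z, AEStronglyMeasurable (fun y => (N y θ).real (box (bins I J) θ z)) ν :=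
    fun θ z => (htr θ z).1.re
  have hreal : ∀ y θ z, ENNReal.ofReal ((N y θ).real (box (bins I J) θ z)) =
      N y θ (box (bins I J) θ z) := fun y θ z => ofReal_measureReal (measure_ne_top _ _)
  have hmeas' : ∀ θ z, AEMeasurable (fun y => N y θ (box (bins I J) θ z)) ν := fun θ z => by
    have := (hmeas θ z).aemeasurable.ennreal_ofReal
    simpa only [hreal] using this
  have hp : ∀ θ z, outcomeProb ħ I J ρ θ z = ∫ y, (N y θ).real (box (bins I J) θ z) ∂ν := by
    intro θ z
    rw [outcomeProb, (htr θ z).2, integral_complex_ofReal, Complex.ofReal_re]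
  have hnn : ∀ θ z, 0 ≤ outcomeProb ħ I J ρ θ z := fun θ z => by
    rw [hp]
    exact integral_nonneg fun y => measureReal_nonneg
  have hl : ∀ θ z, ENNReal.ofReal (outcomeProb ħ I J ρ θ z) =
      ∫⁻ y, N y θ (box (bins I J) θ z) ∂ν := by
    intro θ z
    rw [hp, ofReal_integral_eq_lintegral_ofReal]
    · simp only [hreal]
    · exact .of_bound (hmeas θ z) 1 (Eventually.of_forall fun y => by
        rw [Real.norm_of_nonneg measureReal_nonneg]
        exact measureReal_le_one)
    · exact Eventually.of_forall fun y => measureReal_nonneg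
  refine ⟨hnn, fun θ => ?_, fun α hα => ?_⟩
  · have hs : ∑' z, ENNReal.ofReal (outcomeProb ħ I J ρ θ z) = 1 := by
      simp only [hl]
      rw [← lintegral_tsum fun z => hmeas' θ z]
      simp only [tsum_measure_box, lintegral_one, measure_univ]
    have := ENNReal.hasSum_toReal (f := fun z => ENNReal.ofReal (outcomeProb ħ I J ρ θ z))
      (by rw [hs]; exact ENNReal.one_ne_top)
    rw [← ENNReal.tsum_toReal_eq fun z => ENNReal.ofReal_ne_top, hs, ENNReal.toReal_one] at this
    simpa only [ENNReal.toReal_ofReal (hnn _ _)] using this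
  · calc ∑ θ, ∑' z, ENNReal.ofReal (outcomeProb ħ I J ρ θ z) ^ α
        ≤ ∑ θ, ∑' z, ∫⁻ y, N y θ (box (bins I J) θ z) ^ α ∂ν := by
          refine Finset.sum_le_sum fun θ _ => ENNReal.tsum_le_tsum fun z => ?_
          rw [hl]
          refine (lintegral_rpow_le_mul ν hα (hmeas' θ z)).trans_eq ?_
          rw [measure_univ, ENNReal.one_rpow, one_mul]
      _ = ∫⁻ y, ∑ θ, ∑' z, N y θ (box (bins I J) θ z) ^ α ∂ν := by
          rw [lintegral_finsetSum' _ fun θ _ =>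
            AEMeasurable.tsum fun z => (hmeas' θ z).pow_const α]
          refine Finset.sum_congr rfl fun θ _ => ?_
          rw [lintegral_tsum fun z => (hmeas' θ z).pow_const α]
      _ ≤ ∫⁻ _, ENNReal.ofReal (1 + 1 / α * (δx * δp / (Real.pi * ħ)) ^ (α - 1)) ^ n ∂ν :=
          lintegral_mono fun y => hNα y α hα
      _ = _ := by rw [lintegral_const, measure_univ, mul_one]

/-! ### Smoothing a distribution with bounded power sum -/

/-- On an infinite set, a distribution can be cut off at any level `l > 0` and the lost mass be
redistributed below that level. -/
theorem exists_capped {Z : Type*} [Infinite Z] (g : PMF Z) {l : ℝ≥0∞} (hl : l ≠ 0) (hl' : l ≠ ∞) :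
    ∃ h : PMF Z, (∀ z, h z ≤ l) ∧ ∀ z, min (g z) l ≤ h z := by
  classical
  set S : ℝ≥0∞ := ∑' z, min (g z) l with hS
  have hS1 : S ≤ 1 := (ENNReal.tsum_le_tsum fun z => min_le_left _ _).trans_eq g.tsum_coe
  have hfin : {z | l / 2 ≤ g z}.Finite :=
    ENNReal.finite_const_le_of_tsum_ne_top (by rw [g.tsum_coe]; exact ENNReal.one_ne_top)
      (ENNReal.half_pos hl).ne'
  obtain ⟨M, hM⟩ := ENNReal.exists_nat_gt (ENNReal.div_ne_top ENNReal.ofNat_ne_top hl : 2 / l ≠ ∞)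
  obtain ⟨F, hF, hFM⟩ := hfin.infinite_compl.exists_subset_card_eq M
  have hM0 : (M : ℝ≥0∞) ≠ 0 := (bot_lt_iff_ne_bot.1 (bot_le.trans_lt hM))
  have hMt : (M : ℝ≥0∞) ≠ ∞ := ENNReal.natCast_ne_top M
  set f : Z → ℝ≥0∞ := fun z => min (g z) l + if z ∈ F then (1 - S) / M else 0 with hf
  have hfs : ∑' z, f z = 1 := by
    rw [hf, ENNReal.tsum_add, ← hS, tsum_eq_sum (s := F) fun z hz => if_neg hz,
      Finset.sum_congr rfl fun z hz => if_pos hz, Finset.sum_const, hFM, nsmul_eq_mul,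
      ENNReal.mul_div_cancel hM0 hMt, add_tsub_cancel_of_le hS1]
  refine ⟨⟨f, hfs ▸ ENNReal.summable.hasSum⟩, fun z => ?_, fun z => le_self_add⟩
  change min (g z) l + (if z ∈ F then (1 - S) / M else 0) ≤ l
  split_ifs with hz
  · have h1 : g z ≤ l / 2 := (not_le.1 (show ¬l / 2 ≤ g z from hF hz)).le
    have h2 : (1 - S) / M ≤ l / 2 := by
      refine ENNReal.div_le_of_le_mul (tsub_le_self.trans ?_)
      have h3 : (2 : ℝ≥0∞) ≤ M * l := (ENNReal.div_le_iff_le_mul (Or.inl hl) (Or.inl hl')).1 hM.le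
      calc (1 : ℝ≥0∞) = 2 / 2 := (ENNReal.div_self two_ne_zero ENNReal.ofNat_ne_top).symm
        _ ≤ M * l / 2 := by gcongr
        _ = l / 2 * M := by rw [mul_comm, ENNReal.mul_div_right_comm]
    calc min (g z) l + (1 - S) / M ≤ l / 2 + l / 2 := add_le_add ((min_le_left _ _).trans h1) h2
      _ = l := ENNReal.add_halves l
  · rw [add_zero]
    exact min_le_right _ _

/-- The mass above the level `l` is controlled by the power sum. -/
theorem le_min_add_rpow {x l : ℝ≥0∞} (hx : x ≠ ∞) (hl : l ≠ 0) {α : ℝ} (hα : 1 < α) :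
    x ≤ min x l + x ^ α * l ^ (1 - α) := by
  rcases le_total x l with h | h
  · rw [min_eq_left h]
    exact le_self_add
  · have hx0 : x ≠ 0 := (lt_of_lt_of_le (pos_iff_ne_zero.2 hl) h).ne'
    refine le_trans ?_ le_add_self
    calc x = x ^ α * x ^ (1 - α) := by
          rw [← ENNReal.rpow_add _ _ hx0 hx, add_sub_cancel, ENNReal.rpow_one]
      _ ≤ x ^ α * l ^ (1 - α) := by
          refine mul_le_mul' le_rfl ?_
          rw [← neg_sub, ENNReal.rpow_neg, ENNReal.rpow_neg]
          exact ENNReal.inv_le_inv.2 (ENNReal.rpow_le_rpow h (by linarith))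

/-- The joint distribution of `(Z, Y)` for a distribution of `Y` and conditional distributions of
`Z`. -/
noncomputable def jointPMF {Z Y : Type*} (r : PMF Y) (g : Y → PMF Z) : PMF (Z × Y) :=
  ⟨fun w => r w.2 * g w.2 w.1, by
    have : ∑' w : Z × Y, r w.2 * g w.2 w.1 = 1 := by
      rw [ENNReal.tsum_prod', ENNReal.tsum_comm]
      simp only [ENNReal.tsum_mul_left, PMF.tsum_coe, mul_one]
    exact this ▸ ENNReal.summable.hasSum⟩

theorem jointPMF_apply {Z Y : Type*} (r : PMF Y) (g : Y → PMF Z) (w : Z × Y) :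
    jointPMF r g w = r w.2 * g w.2 w.1 := rfl

theorem summable_toReal {W : Type*} (p : PMF W) : Summable fun w => (p w).toReal :=
  ENNReal.summable_toReal (by rw [p.tsum_coe]; exact ENNReal.one_ne_top)

/-- If all conditional probabilities are at most `l`, so is the guessing probability. -/
theorem le_minEntropy_jointPMF {Z Y : Type*} (r : PMF Y) (g : Y → PMF Z) {l : ℝ} (hl : 0 < l)
    (h : ∀ y z, g y z ≤ ENNReal.ofReal l) : -Real.logb 2 l ≤ minEntropy (jointPMF r g) := by
  set q := jointPMF r g
  have hne : ∀ (e : Y → PMF Z) w, q w * e w.2 w.1 ≠ ∞ := fun e w =>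
    ENNReal.mul_ne_top (q.apply_ne_top w) ((e w.2).apply_ne_top w.1)
  have hle : ∀ e : Y → PMF Z, ∑' w, q w * e w.2 w.1 ≤ ENNReal.ofReal l := by
    intro e
    calc ∑' w, q w * e w.2 w.1 ≤ ∑' w : Z × Y, ENNReal.ofReal l * (r w.2 * e w.2 w.1) := by
          refine ENNReal.tsum_le_tsum fun w => ?_
          rw [jointPMF_apply, mul_right_comm, mul_comm (ENNReal.ofReal l)]
          gcongr
          exact h _ _
      _ = ENNReal.ofReal l := by
          rw [ENNReal.tsum_mul_left]
          have := (jointPMF r e).tsum_coe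
          simp only [jointPMF_apply] at this
          rw [this, mul_one]
  have heq : ∀ e : Y → PMF Z, ∑' w, (q w).toReal * (e w.2 w.1).toReal =
      (∑' w, q w * e w.2 w.1).toReal := by
    intro e
    rw [ENNReal.tsum_toReal_eq (hne e)]
    simp only [ENNReal.toReal_mul]
  have hle' : ∀ e : Y → PMF Z, ∑' w, (q w).toReal * (e w.2 w.1).toReal ≤ l := fun e => by
    rw [heq]
    exact ENNReal.toReal_le_of_le_ofReal hl.le (hle e)
  obtain ⟨w, hw⟩ := q.support_nonempty
  have : Nonempty (Y → PMF Z) := ⟨g⟩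
  have hpos : 0 < guessProb q := by
    refine lt_of_lt_of_le ?_ (le_ciSup (f := fun e : Y → PMF Z =>
      ∑' w, (q w).toReal * (e w.2 w.1).toReal) ⟨l, ?_⟩ fun _ => PMF.pure w.1)
    · refine lt_of_lt_of_eq ?_ (heq fun _ => PMF.pure w.1).symm
      refine ENNReal.toReal_pos (fun h0 => ?_) 
        ((hle fun _ => PMF.pure w.1).trans_lt ENNReal.ofReal_lt_top).ne
      have := ENNReal.tsum_eq_zero.1 h0 w
      simp at this
      exact hw this
    · rintro _ ⟨e, rfl⟩
      exact hle' e
  rw [minEntropy, neg_le_neg_iff]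
  exact Real.logb_le_logb_of_le one_lt_two hpos (ciSup_le hle')

/-- If two distributions share the mass `1 - ε² / 2`, their purified distance is at most `ε`. -/
theorem purifiedDist_le {W : Type*} {p q : PMF W} {ε : ℝ} (hε : 0 < ε) (hε1 : ε ≤ 1)
    {m : W → ℝ≥0∞} (hp : ∀ w, m w ≤ p w) (hq : ∀ w, m w ≤ q w)
    (hm : 1 ≤ ∑' w, m w + ENNReal.ofReal (ε ^ 2 / 2)) :
    purifiedDist (fun w => (p w).toReal) q ≤ ε := by
  have hmt : ∑' w, m w ≠ ∞ := ((ENNReal.tsum_le_tsum hp).trans_lt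
    (by rw [p.tsum_coe]; exact ENNReal.one_lt_top)).ne
  have hm0 : ∀ w, m w ≠ ∞ := fun w => ((hp w).trans_lt (p.apply_lt_top w)).ne
  have h1 : 1 - ε ^ 2 / 2 ≤ ∑' w, (m w).toReal := by
    rw [← ENNReal.tsum_toReal_eq hm0]
    have := ENNReal.toReal_mono (ENNReal.add_ne_top.2 ⟨hmt, ENNReal.ofReal_ne_top⟩) hm
    rw [ENNReal.toReal_add hmt ENNReal.ofReal_ne_top, ENNReal.toReal_one,
      ENNReal.toReal_ofReal (by positivity)] at this
    linarith
  have h2 : ∑' w, (m w).toReal ≤ ∑' w, √(p w).toReal * √(q w).toReal := by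
    refine Summable.tsum_le_tsum (fun w => ?_) (ENNReal.summable_toReal hmt) ?_
    · rw [← Real.mul_self_sqrt (ENNReal.toReal_nonneg (a := m w))]
      gcongr
      · exact p.apply_ne_top w
      · exact hp w
      · exact q.apply_ne_top w
      · exact hq w
    · refine Summable.of_nonneg_of_le (fun w => by positivity) (fun w => ?_)
        (((summable_toReal p).add (summable_toReal q)).mul_left (1 / 2))
      have e1 := Real.sq_sqrt (ENNReal.toReal_nonneg (a := p w))
      have e2 := Real.sq_sqrt (ENNReal.toReal_nonneg (a := q w))
      nlinarith [sq_nonneg (√(p w).toReal - √(q w).toReal)]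
  rw [purifiedDist, Real.sqrt_le_left hε.le]
  have h3 : 0 ≤ 1 - ε ^ 2 / 2 := by nlinarith
  nlinarith [mul_self_le_mul_self h3 (h1.trans h2), sq_nonneg (ε ^ 2)]

/-- The smooth min-entropy is bounded below by the Rényi entropy, written as a bound on the power
sum: conditional probabilities above `l` carry at most the mass `ε² / 2`, and can be cut off. -/
theorem neg_logb_le_smoothMinEntropy {Z Y : Type*} [Infinite Z] (r : PMF Y) (g : Y → PMF Z)
    {α ε l : ℝ} (hα : 1 < α) (hε : 0 < ε) (hε1 : ε ≤ 1) (hl : 0 < l)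
    (h : ∑' y, r y * ∑' z, g y z ^ α ≤ ENNReal.ofReal (ε ^ 2 / 2 * l ^ (α - 1))) :
    ((-Real.logb 2 l : ℝ) : EReal) ≤
      smoothMinEntropy ε fun w : Z × Y => (jointPMF r g w).toReal := by
  set L := ENNReal.ofReal l with hL
  have hL0 : L ≠ 0 := by simpa [hL] using hl
  have hLt : L ≠ ∞ := ENNReal.ofReal_ne_top
  choose f hfl hfm using fun y => exists_capped (g y) hL0 hLt
  refine le_iSup₂_of_le (jointPMF r f) ?_ (EReal.coe_le_coe_iff.2 (le_minEntropy_jointPMF r f hl hfl))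
  refine purifiedDist_le hε hε1 (m := fun w => r w.2 * min (g w.2 w.1) L)
    (fun w => mul_le_mul_right (min_le_left _ _) _) (fun w => mul_le_mul_right (hfm _ _) _) ?_
  calc (1 : ℝ≥0∞) = ∑' w, jointPMF r g w := (PMF.tsum_coe _).symm
    _ ≤ ∑' w : Z × Y, (r w.2 * min (g w.2 w.1) L + r w.2 * g w.2 w.1 ^ α * L ^ (1 - α)) := by
        refine ENNReal.tsum_le_tsum fun w => ?_
        rw [jointPMF_apply, mul_assoc, ← mul_add]
        gcongr
        exact le_min_add_rpow ((g _).apply_ne_top _) hL0 hα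
    _ = ∑' w : Z × Y, r w.2 * min (g w.2 w.1) L + (∑' y, r y * ∑' z, g y z ^ α) * L ^ (1 - α) := by
        rw [ENNReal.tsum_add, ENNReal.tsum_mul_right]
        congr 2
        rw [ENNReal.tsum_prod', ENNReal.tsum_comm]
        simp only [ENNReal.tsum_mul_left]
    _ ≤ _ := by
        gcongr
        calc (∑' y, r y * ∑' z, g y z ^ α) * L ^ (1 - α)
            ≤ ENNReal.ofReal (ε ^ 2 / 2 * l ^ (α - 1)) * L ^ (1 - α) := by gcongr
          _ = ENNReal.ofReal (ε ^ 2 / 2) := by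
              rw [hL, ENNReal.ofReal_rpow_of_pos hl, ← ENNReal.ofReal_mul (by positivity),
                mul_assoc, ← Real.rpow_add hl]
              simp

/-! ### The asymptotics of the bounds -/

theorem logb_overlap {ħ δx δp : ℝ} (hħ : 0 < ħ) (hδx : 0 < δx) (hδp : 0 < δp) :
    Real.logb 2 (overlap ħ δx δp) =
      (Real.log (δx * δp / (Real.pi * ħ)) - 1) / Real.log 2 := by
  have e : overlap ħ δx δp = δx * δp / (Real.pi * ħ) / Real.exp 1 := by
    rw [overlap, div_div]
    ring_nf
  rw [Real.logb, e, Real.log_div (by positivity) (by positivity), Real.log_exp]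

/-- `B^α ≤ -½ log c` for all `α`, by the inequality of arithmetic and geometric means and
`log α ≤ α - 1`. -/
theorem gaussBound_le {ħ δx δp α : ℝ} (hħ : 0 < ħ) (hδx : 0 < δx) (hδp : 0 < δp) (hα : 1 < α) :
    gaussBound ħ δx δp α ≤ -(1 / 2) * Real.logb 2 (overlap ħ δx δp) := by
  set r := δx * δp / (Real.pi * ħ) with hr
  have hr0 : 0 < r := by positivity
  have hα0 : 0 < α := by linarith
  have hα1 : 0 < α - 1 := by linarith
  have h2 : 0 < Real.log 2 := Real.log_pos one_lt_two
  set x := 1 / α * r ^ (α - 1) with hx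
  have hx0 : 0 < x := by positivity
  have hlog : Real.log x = (α - 1) * Real.log r - Real.log α := by
    rw [hx, Real.log_mul (by positivity) (by positivity), Real.log_rpow hr0, one_div,
      Real.log_inv]
    ring
  have h1 : 1 / 2 * Real.log x ≤ Real.log (1 / 2 * (1 + x)) := by
    have e : 1 / 2 * Real.log x = Real.log (√x) := by
      rw [Real.log_sqrt hx0.le]
      ring
    rw [e]
    refine Real.log_le_log (by positivity) ?_
    nlinarith [sq_nonneg (√x - 1), Real.sq_sqrt hx0.le]
  have h3 : Real.log α ≤ α - 1 := Real.log_le_sub_one_of_pos hα0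
  have e1 : gaussBound ħ δx δp α =
      -(Real.log (1 / 2 * (1 + x)) / (α - 1)) / Real.log 2 := by
    rw [gaussBound, Real.logb, ← neg_sub α 1, ← hr, ← hx, one_div_neg_eq_neg_one_div]
    ring
  rw [e1, logb_overlap hħ hδx hδp, ← hr, ← mul_div_assoc, div_le_div_iff_of_pos_right h2]
  have h4 : 1 / 2 * (Real.log r - 1) ≤ Real.log (1 / 2 * (1 + x)) / (α - 1) := by
    rw [le_div_iff₀ hα1]
    nlinarith
  linarith

theorem tendsto_gaussBound {ħ δx δp : ℝ} (hħ : 0 < ħ) (hδx : 0 < δx) (hδp : 0 < δp) :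
    Tendsto (fun α : ℝ => gaussBound ħ δx δp α) (𝓝[>] 1)
      (𝓝 (-(1 / 2) * Real.logb 2 (overlap ħ δx δp))) := by
  set r := δx * δp / (Real.pi * ħ) with hr
  have hr0 : 0 < r := by positivity
  -- the bound is minus the difference quotient of this function at `1`
  set F : ℝ → ℝ := fun α => Real.logb 2 (1 / 2 * (1 + 1 / α * r ^ (α - 1))) with hF
  have hF1 : F 1 = 0 := by norm_num [hF]
  have hd : HasDerivAt F (1 / 2 * Real.logb 2 (overlap ħ δx δp)) 1 := by
    have h1 : HasDerivAt (fun α : ℝ => 1 / α) (-1) 1 := by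
      simpa using hasDerivAt_inv (one_ne_zero (α := ℝ))
    have h2 : HasDerivAt (fun α : ℝ => r ^ (α - 1)) (Real.log r) 1 := by
      simpa using ((hasDerivAt_id (1 : ℝ)).sub_const 1).const_rpow hr0
    have h3 := (((h1.mul h2).const_add 1).const_mul (1 / 2)).log (by simp)
    have h4 := h3.div_const (Real.log 2)
    refine h4.congr_deriv ?_
    rw [logb_overlap hħ hδx hδp, ← hr]
    simp
    ring
  have h := hd.tendsto_slope.mono_left
    (nhdsWithin_mono (1 : ℝ) fun x (hx : x ∈ Set.Ioi 1) => (ne_of_gt hx : x ≠ 1))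
  have h' := h.neg
  rw [← neg_mul] at h'
  refine h'.congr' ?_
  filter_upwards [self_mem_nhdsWithin] with α hα
  rw [slope_def_field, hF1, gaussBound, ← neg_sub α 1, sub_zero, ← hr,
    one_div_neg_eq_neg_one_div]
  ring

theorem tendsto_gaussRate {ħ δx δp : ℝ} (hħ : 0 < ħ) (hδx : 0 < δx) (hδp : 0 < δp) {ε : ℝ}
    (hε : 0 < ε) (hε1 : ε ≤ 1) :
    Tendsto (fun n : ℕ => gaussRate ħ δx δp ε n) atTop
      (𝓝 (-(1 / 2) * Real.logb 2 (overlap ħ δx δp))) := by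
  set L := Real.logb 2 (2 / ε ^ 2) with hL
  have hL0 : 0 ≤ L := by
    refine Real.logb_nonneg one_lt_two ?_
    rw [le_div_iff₀ (by positivity)]
    nlinarith
  set C := -(1 / 2) * Real.logb 2 (overlap ħ δx δp) with hC
  have hle : ∀ (n : ℕ) (α : Set.Ioc (1 : ℝ) 2),
      gaussBound ħ δx δp α - 1 / (n * ((α : ℝ) - 1)) * L ≤ C := by
    intro n α
    have h1 : (0 : ℝ) ≤ α - 1 := by linarith [α.2.1]
    have h2 : 0 ≤ 1 / (n * ((α : ℝ) - 1)) * L := by positivity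
    linarith [gaussBound_le hħ hδx hδp α.2.1]
  have : Nonempty (Set.Ioc (1 : ℝ) 2) := ⟨⟨2, by norm_num⟩⟩
  -- the lower bound comes from `α = 1 + 1 / √n`
  set a : ℕ → ℝ := fun n => 1 + 1 / √n with ha
  have ha0 : Tendsto (fun n : ℕ => 1 / √(n : ℝ)) atTop (𝓝 0) := by
    have := (Real.tendsto_sqrt_atTop.comp
      (tendsto_natCast_atTop_atTop (R := ℝ))).inv_tendsto_atTop
    simp only [one_div]
    exact this
  have ha1 : Tendsto a atTop (𝓝[>] 1) := by
    refine tendsto_nhdsWithin_iff.2 ⟨by simpa only [add_zero] using ha0.const_add 1, ?_⟩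
    filter_upwards [eventually_gt_atTop 0] with n hn
    have : (0 : ℝ) < n := by exact_mod_cast hn
    have : 0 < 1 / √(n : ℝ) := by positivity
    simp only [ha, Set.mem_Ioi]
    linarith
  have hlow : Tendsto (fun n : ℕ => gaussBound ħ δx δp (a n) - 1 / √(n : ℝ) * L) atTop (𝓝 C) := by
    have := ((tendsto_gaussBound hħ hδx hδp).comp ha1).sub (ha0.mul_const L)
    rwa [zero_mul, sub_zero] at this
  refine tendsto_of_tendsto_of_tendsto_of_le_of_le' hlow tendsto_const_nhds ?_
    (Eventually.of_forall fun n => ciSup_le (hle n))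
  filter_upwards [eventually_ge_atTop 1] with n hn
  have hn' : (1 : ℝ) ≤ n := by exact_mod_cast hn
  have hs : 1 ≤ √(n : ℝ) := Real.one_le_sqrt.2 hn'
  have hm : a n ∈ Set.Ioc (1 : ℝ) 2 := by
    have h1 : 0 < 1 / √(n : ℝ) := by positivity
    have h2 : 1 / √(n : ℝ) ≤ 1 := (div_le_one (by positivity)).2 hs
    constructor <;> simp only [ha] <;> linarith
  refine le_trans (le_of_eq ?_) (le_ciSup (f := fun α : Set.Ioc (1 : ℝ) 2 =>
    gaussBound ħ δx δp α - 1 / (n * ((α : ℝ) - 1)) * L) ⟨C, ?_⟩ ⟨a n, hm⟩)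
  · simp only [ha]
    congr 2
    rw [add_sub_cancel_left]
    nth_rw 2 [← Real.mul_self_sqrt (by linarith : (0 : ℝ) ≤ n)]
    field_simp
  · rintro _ ⟨α, rfl⟩
    exact hle n α

/-! ### Entropic uncertainty relations for Gaussian mixtures -/

/-- The average of the power sums over uniformly random bases. -/
theorem IsGaussianMixture.sum_uniform_rpow_le {n : ℕ} {ħ δx δp : ℝ} (hħ : 0 < ħ) (hδx : 0 < δx)
    (hδp : 0 < δp) (I : Binning δx) (J : Binning δp) {ρ : State n}
    (hρ : IsGaussianMixture.{u} ħ ρ) {α : ℝ} (hα : 1 < α) :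
    ∑ θ, ENNReal.ofReal ((1 / 2) ^ n) * ∑' z, ENNReal.ofReal (outcomeProb ħ I J ρ θ z) ^ α ≤
      ENNReal.ofReal ((1 / 2 * (1 + 1 / α * (δx * δp / (Real.pi * ħ)) ^ (α - 1))) ^ n) := by
  rw [← Finset.mul_sum, mul_pow, ENNReal.ofReal_mul (by positivity),
    ENNReal.ofReal_pow (p := 1 + _) (by positivity)]
  gcongr
  exact (hρ.outcomeProb_bounds hħ hδx hδp I J).2.2 α hα

theorem n_mul_gaussBound {ħ δx δp α : ℝ} (n : ℕ) :
    n * gaussBound ħ δx δp α = 1 / (1 - α) *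
      Real.logb 2 ((1 / 2 * (1 + 1 / α * (δx * δp / (Real.pi * ħ)) ^ (α - 1))) ^ n) := by
  rw [gaussBound, Real.logb_pow]
  ring

theorem n_mul_gaussBound_le_condRenyi {n : ℕ} {ħ δx δp : ℝ} (hħ : 0 < ħ) (hδx : 0 < δx)
    (hδp : 0 < δp) (I : Binning δx) (J : Binning δp) {ρ : State n}
    (hρ : IsGaussianMixture.{u} ħ ρ) {α : ℝ} (hα : 1 < α) :
    n * gaussBound ħ δx δp α ≤ condRenyi α (outcomeDist ħ I J ρ) := by
  obtain ⟨h0, h1, -⟩ := hρ.outcomeProb_bounds hħ hδx hδp I J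
  have h2 := hρ.sum_uniform_rpow_le hħ hδx hδp I J hα
  set P := outcomeProb ħ I J ρ with hP
  have hα0 : 0 < α := by linarith
  set D := (1 / 2 * (1 + 1 / α * (δx * δp / (Real.pi * ħ)) ^ (α - 1))) ^ n with hD
  set F : (Fin n → ℕ) × (Fin n → Bool) → ℝ := fun w => (1 / 2) ^ n * P w.2 w.1 ^ α with hF
  have hF0 : ∀ w, 0 ≤ F w := fun w =>
    mul_nonneg (by positivity) (Real.rpow_nonneg (h0 _ _) _)
  have hterm : ∀ w : (Fin n → ℕ) × (Fin n → Bool), outcomeDist ħ I J ρ w ^ α *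
      (∑' z, outcomeDist ħ I J ρ (z, w.2)) ^ (1 - α) = F w := by
    intro w
    have e : ∑' z, outcomeDist ħ I J ρ (z, w.2) = (1 / 2) ^ n := by
      simp only [outcomeDist, ← hP]
      rw [tsum_mul_left, (h1 w.2).tsum_eq, mul_one]
    rw [e, outcomeDist, ← hP, Real.mul_rpow (by positivity) (h0 _ _), mul_right_comm,
      ← Real.rpow_add (by positivity), add_sub_cancel, Real.rpow_one]
  have hsum : ∑' w, ENNReal.ofReal (F w) ≤ ENNReal.ofReal D := by
    refine le_trans (le_of_eq ?_) h2
    rw [ENNReal.tsum_prod', ENNReal.tsum_comm, tsum_fintype]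
    refine Finset.sum_congr rfl fun θ _ => ?_
    rw [← ENNReal.tsum_mul_left]
    refine tsum_congr fun z => ?_
    rw [hF, ENNReal.ofReal_mul (by positivity), ENNReal.ofReal_rpow_of_nonneg (h0 _ _) hα0.le]
  have hne : ∑' w, ENNReal.ofReal (F w) ≠ ∞ := (hsum.trans_lt ENNReal.ofReal_lt_top).ne
  have hFs : Summable F := by
    simpa only [ENNReal.toReal_ofReal (hF0 _)] using ENNReal.summable_toReal hne
  have hFD : ∑' w, F w ≤ D := by
    rw [← ENNReal.ofReal_le_ofReal_iff (by positivity), ENNReal.ofReal_tsum_of_nonneg hF0 hFs]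
    exact hsum
  have hFpos : 0 < ∑' w, F w := by
    set θ : Fin n → Bool := fun _ => false
    obtain ⟨z, hz⟩ : ∃ z, P θ z ≠ 0 := by
      by_contra! hz
      have := (h1 θ).tsum_eq
      simp [hz] at this
    exact hFs.tsum_pos hF0 (z, θ)
      (mul_pos (by positivity) (Real.rpow_pos_of_pos ((h0 _ _).lt_of_ne' hz) _))
  rw [n_mul_gaussBound, condRenyi]
  simp only [hterm]
  refine mul_le_mul_of_nonpos_left (Real.logb_le_logb_of_le one_lt_two hFpos hFD) ?_
  exact one_div_nonpos.2 (by linarith)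

/-- The outcome distribution of a Gaussian mixture. -/
noncomputable def IsGaussianMixture.outcomePMF {n : ℕ} {ħ δx δp : ℝ} (hħ : 0 < ħ) (hδx : 0 < δx)
    (hδp : 0 < δp) (I : Binning δx) (J : Binning δp) {ρ : State n}
    (hρ : IsGaussianMixture.{u} ħ ρ) (θ : Fin n → Bool) : PMF (Fin n → ℕ) :=
  ⟨fun z => ENNReal.ofReal (outcomeProb ħ I J ρ θ z), by
    obtain ⟨h0, h1, -⟩ := hρ.outcomeProb_bounds hħ hδx hδp I J
    have : ∑' z, ENNReal.ofReal (outcomeProb ħ I J ρ θ z) = 1 := by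
      rw [← ENNReal.ofReal_tsum_of_nonneg (h0 θ) (h1 θ).summable, (h1 θ).tsum_eq,
        ENNReal.ofReal_one]
    exact this ▸ ENNReal.summable.hasSum⟩

theorem n_mul_gaussRate_le_smoothMinEntropy {n : ℕ} (hn : 1 ≤ n) {ħ δx δp : ℝ} (hħ : 0 < ħ)
    (hδx : 0 < δx) (hδp : 0 < δp) (I : Binning δx) (J : Binning δp) {K : Type v} (κ : PMF K)
    {ρ : K → State n} (hρ : ∀ k, IsGaussianMixture.{u} ħ (ρ k)) {ε : ℝ} (hε : 0 < ε)
    (hε1 : ε ≤ 1) :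
    ((n * gaussRate ħ δx δp ε n : ℝ) : EReal) ≤
      smoothMinEntropy ε (outcomeDistSide ħ I J κ ρ) := by
  have hn0 : (0 : ℝ) < n := by exact_mod_cast hn
  have : Nonempty (Fin n) := ⟨⟨0, hn⟩⟩
  set r : PMF ((Fin n → Bool) × K) := jointPMF κ fun _ => PMF.uniformOfFintype (Fin n → Bool)
  set g : (Fin n → Bool) × K → PMF (Fin n → ℕ) := fun y =>
    (hρ y.2).outcomePMF hħ hδx hδp I J y.1
  have hunif : ∀ θ : Fin n → Bool,
      PMF.uniformOfFintype (Fin n → Bool) θ = ENNReal.ofReal ((1 / 2) ^ n) := by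
    intro θ
    rw [PMF.uniformOfFintype_apply, ENNReal.ofReal_pow (by norm_num)]
    simp [ENNReal.inv_pow, ENNReal.ofReal_inv_of_pos]
  have hdist : outcomeDistSide ħ I J κ ρ = fun w => (jointPMF r g w).toReal := by
    ext w
    have h0 := ((hρ w.2.2).outcomeProb_bounds hħ hδx hδp I J).1
    change _ = (κ w.2.2 * PMF.uniformOfFintype (Fin n → Bool) w.2.1 *
      ENNReal.ofReal (outcomeProb ħ I J (ρ w.2.2) w.2.1 w.1)).toReal
    rw [hunif, ENNReal.toReal_mul, ENNReal.toReal_mul, ENNReal.toReal_ofReal (by positivity),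
      ENNReal.toReal_ofReal (h0 _ _), mul_assoc]
    rfl
  -- the bound for a fixed `α`
  have key : ∀ α : ℝ, 1 < α →
      ((n * (gaussBound ħ δx δp α - 1 / (n * (α - 1)) * Real.logb 2 (2 / ε ^ 2)) : ℝ) : EReal) ≤
        smoothMinEntropy ε (outcomeDistSide ħ I J κ ρ) := by
    intro α hα
    have hα1 : 0 < α - 1 := by linarith
    set D := (1 / 2 * (1 + 1 / α * (δx * δp / (Real.pi * ħ)) ^ (α - 1))) ^ n with hD
    have hD0 : 0 < D := by positivity
    -- the level at which the mass above it is bounded by `ε² / 2`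
    set l := (2 / ε ^ 2 * D) ^ (1 / (α - 1)) with hl
    have hl0 : 0 < l := by positivity
    have hlα : ε ^ 2 / 2 * l ^ (α - 1) = D := by
      rw [hl, ← Real.rpow_mul (by positivity), one_div_mul_cancel hα1.ne', Real.rpow_one]
      field_simp
    have hlog : n * (gaussBound ħ δx δp α - 1 / (n * (α - 1)) * Real.logb 2 (2 / ε ^ 2)) =
        -Real.logb 2 l := by
      rw [mul_sub, n_mul_gaussBound, ← hD, hl, Real.logb_rpow_eq_mul_logb_of_pos (by positivity),
        Real.logb_mul (by positivity) hD0.ne', ← neg_sub α 1, one_div_neg_eq_neg_one_div]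
      field_simp
      ring
    rw [hlog, hdist]
    refine neg_logb_le_smoothMinEntropy r g hα hε hε1 hl0 ?_
    rw [hlα]
    calc ∑' y, r y * ∑' z, g y z ^ α
        = ∑' k, κ k * ∑ θ, ENNReal.ofReal ((1 / 2) ^ n) *
            ∑' z, ENNReal.ofReal (outcomeProb ħ I J (ρ k) θ z) ^ α := by
          rw [ENNReal.tsum_prod', ENNReal.tsum_comm]
          refine tsum_congr fun k => ?_
          rw [tsum_fintype, Finset.mul_sum]
          refine Finset.sum_congr rfl fun θ _ => ?_
          change κ k * PMF.uniformOfFintype (Fin n → Bool) θ * _ = _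
          rw [hunif, mul_assoc]
          rfl
      _ ≤ ∑' k, κ k * ENNReal.ofReal D := by
          gcongr with k
          exact (hρ k).sum_uniform_rpow_le hħ hδx hδp I J hα
      _ = ENNReal.ofReal D := by rw [ENNReal.tsum_mul_right, κ.tsum_coe, one_mul]
  have hne : Nonempty (Set.Ioc (1 : ℝ) 2) := ⟨⟨2, by norm_num⟩⟩
  induction h : smoothMinEntropy ε (outcomeDistSide ħ I J κ ρ) with
  | top => exact le_top
  | bot =>
    have := key 2 one_lt_two
    rw [h] at this
    exact absurd (le_bot_iff.1 this) (EReal.coe_ne_bot _)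
  | coe H =>
    rw [EReal.coe_le_coe_iff, ← le_div_iff₀' hn0]
    refine ciSup_le fun α => ?_
    have := key α α.2.1
    rw [h, EReal.coe_le_coe_iff, ← le_div_iff₀' hn0] at this
    exact this

end CVGauss

theorem theorem1 (ħ δx δp : ℝ) (hħ : 0 < ħ) (hδx : 0 < δx) (hδp : 0 < δp)
    (I : CVGauss.Binning δx) (J : CVGauss.Binning δp) :
    -- one mode: the Rényi entropic uncertainty relation
    (∀ α : ℝ, 1 < α → α ≤ 2 → ∀ ρ : CVGauss.State 1, CVGauss.IsGaussianMixture.{u} ħ ρ →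
      CVGauss.gaussBound ħ δx δp α ≤
        CVGauss.condRenyi α (CVGauss.outcomeDist ħ I J ρ)) ∧
    -- `n` modes with classical side information: the smooth min-entropy rate
    (∀ (n : ℕ), 1 ≤ n → ∀ (K : Type v) (κ : PMF K) (ρ : K → CVGauss.State n),
      (∀ k, CVGauss.IsGaussianMixture.{u} ħ (ρ k)) → ∀ ε : ℝ, 0 < ε → ε ≤ 1 →
      ((n * CVGauss.gaussRate ħ δx δp ε n : ℝ) : EReal) ≤
        CVGauss.smoothMinEntropy ε (CVGauss.outcomeDistSide ħ I J κ ρ)) ∧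
    -- the asymptotic values
    Tendsto (fun α : ℝ => CVGauss.gaussBound ħ δx δp α) (𝓝[>] 1)
      (𝓝 (-(1 / 2) * Real.logb 2 (CVGauss.overlap ħ δx δp))) ∧
    (∀ ε : ℝ, 0 < ε → ε ≤ 1 →
      Tendsto (fun n : ℕ => CVGauss.gaussRate ħ δx δp ε n) atTop
        (𝓝 (-(1 / 2) * Real.logb 2 (CVGauss.overlap ħ δx δp)))) := by
  refine ⟨fun α hα _ ρ hρ => ?_, fun n hn K κ ρ hρ ε hε hε1 => ?_,
    CVGauss.tendsto_gaussBound hħ hδx hδp, fun ε hε hε1 =>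
      CVGauss.tendsto_gaussRate hħ hδx hδp hε hε1⟩
  · simpa using CVGauss.n_mul_gaussBound_le_condRenyi hħ hδx hδp I J hρ hα
  · exact CVGauss.n_mul_gaussRate_le_smoothMinEntropy hn hħ hδx hδp I J κ hρ hε hε1
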